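/- Let $G=(Q,\Delta)$ be a compact quantum group, i.e. $Q$ is a unital $C^*$-algebra and $\Delta\colon Q\to Q\otimes Q$ (minimal tensor product) is a coassociative unital $*$-homomorphism such that the linear spans of $(1\otimes Q)\Delta(Q)$ and $(Q\otimes 1)\Delta(Q)$ are dense in $Q\otimes Q$. A finite-dimensional (unitary) representation of $G$ is a unitary matrix $u=(u_{ij})$ over $Q$ with $\Delta(u_{ij})=\sum_r u_{ir}\otimes u_{rj}$. Let $\mathcal Q_G\subset Q$ be the subalgebra spanned by the matrix coefficients of all finite-dimensional representations, and let $\operatorname{Rep} G$ be the fusion ring of $G$, i.e. the Grothendieck ring of equivalence classes of finite-dimensional representations under direct sum and tensor product. An irreducible representation $u$, with dual $u^*$ given by the coefficients $u_{ij}^*$, is called torsion if, up to equivalence, only finitely many irreducible representations occur as direct summands of the tensor powers of $u\oplus u^*$. Call $G$ - irreducible if $\mathcal Q_G$ is a (possibly noncommutative) domain; - weakly irreducible if $\operatorname{Rep} G$ is a (possibly noncommutative) domain; - connected if every torsion irreducible representation of $G$ is equivalent to the trivial representation. Theorem. For every compact quantum group $G$: if $G$ is irreducible then $G$ is weakly irreducible,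 and if $G$ is weakly irreducible then $G$ is connected. -/

import Mathlib

namespace CQG

noncomputable section

open scoped TensorProduct

universe u

/-! ### The minimal tensor product of unital C⋆-algebras -/

section HilbertTensor

variable {H K : Type u} [NormedAddCommGroup H] [InnerProductSpace ℂ H]
  [NormedAddCommGroup K] [InnerProductSpace ℂ K]

/-- The Hilbert space tensor product `H ⊗̂ K`: the completion of the algebraic tensor product in
the norm of the inner product `⟪x ⊗ y, x' ⊗ y'⟫ = ⟪x, x'⟫ ⟪y, y'⟫`. -/
def HilbertTensor (H K : Type u) [NormedAddCommGroup H] [InnerProductSpace ℂ H]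
    [NormedAddCommGroup K] [InnerProductSpace ℂ K] : Type u :=
  UniformSpace.Completion (H ⊗[ℂ] K)

instance : NormedAddCommGroup (HilbertTensor H K) :=
  inferInstanceAs (NormedAddCommGroup (UniformSpace.Completion (H ⊗[ℂ] K)))

instance : InnerProductSpace ℂ (HilbertTensor H K) :=
  inferInstanceAs (InnerProductSpace ℂ (UniformSpace.Completion (H ⊗[ℂ] K)))

instance : CompleteSpace (HilbertTensor H K) :=
  inferInstanceAs (CompleteSpace (UniformSpace.Completion (H ⊗[ℂ] K)))

/-- The inclusion of the algebraic tensor product into the Hilbert space tensor product. -/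
def toHilbert : H ⊗[ℂ] K →ₗᵢ[ℂ] HilbertTensor H K :=
  UniformSpace.Completion.toComplₗᵢ

theorem denseRange_toHilbert : DenseRange (toHilbert : H ⊗[ℂ] K → HilbertTensor H K) :=
  UniformSpace.Completion.denseRange_coe

theorem inner_toHilbert (x y : H ⊗[ℂ] K) :
    inner ℂ (toHilbert x) (toHilbert y) = inner ℂ x y :=
  toHilbert.inner_map_map x y

/-- The bounded operator `S ⊗ T` on `H ⊗̂ K`. -/
def opTensor (S : H →L[ℂ] H) (T : K →L[ℂ] K) :
    HilbertTensor H K →L[ℂ] HilbertTensor H K :=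
  (toHilbert.toContinuousLinearMap ∘L TensorProduct.mapL S T).extend
    toHilbert.toContinuousLinearMap

theorem opTensor_toHilbert (S : H →L[ℂ] H) (T : K →L[ℂ] K) (x : H ⊗[ℂ] K) :
    opTensor S T (toHilbert x) = toHilbert (TensorProduct.mapL S T x) :=
  ContinuousLinearMap.extend_eq (e := toHilbert.toContinuousLinearMap)
    (toHilbert.toContinuousLinearMap ∘L TensorProduct.mapL S T) denseRange_toHilbert
    toHilbert.isometry.isUniformInducing x

theorem op_ext {S T : HilbertTensor H K →L[ℂ] HilbertTensor H K}
    (h : ∀ x : H ⊗[ℂ] K, S (toHilbert x) = T (toHilbert x)) : S = T := by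
  ext x
  induction x using denseRange_toHilbert.induction_on with
  | hp => exact isClosed_eq S.continuous T.continuous
  | ih x => exact h x

theorem norm_opTensor_le (S : H →L[ℂ] H) (T : K →L[ℂ] K) : ‖opTensor S T‖ ≤ ‖S‖ * ‖T‖ := by
  refine ContinuousLinearMap.opNorm_le_bound _ (by positivity) fun x => ?_
  induction x using denseRange_toHilbert.induction_on with
  | hp => apply isClosed_le <;> fun_prop
  | ih x =>
    rw [opTensor_toHilbert, LinearIsometry.norm_map, LinearIsometry.norm_map]
    exact (ContinuousLinearMap.le_opNorm _ _).trans
      (mul_le_mul_of_nonneg_right (TensorProduct.norm_mapL_le S T) (norm_nonneg _))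

theorem opTensor_one : opTensor (1 : H →L[ℂ] H) (1 : K →L[ℂ] K) = 1 := by
  refine op_ext fun x => ?_
  rw [opTensor_toHilbert]
  have : TensorProduct.mapL (1 : H →L[ℂ] H) (1 : K →L[ℂ] K) = .id ℂ _ :=
    TensorProduct.mapL_id_id
  rw [this]; rfl

theorem opTensor_mul (S S' : H →L[ℂ] H) (T T' : K →L[ℂ] K) :
    opTensor (S * S') (T * T') = opTensor S T * opTensor S' T' := by
  refine op_ext fun x => ?_
  simp [TensorProduct.mapL_mul, opTensor_toHilbert]

theorem opTensor_add_left (S S' : H →L[ℂ] H) (T : K →L[ℂ] K) :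
    opTensor (S + S') T = opTensor S T + opTensor S' T := by
  refine op_ext fun x => ?_
  rw [opTensor_toHilbert, TensorProduct.mapL_add_left]
  simp [opTensor_toHilbert]

theorem opTensor_add_right (S : H →L[ℂ] H) (T T' : K →L[ℂ] K) :
    opTensor S (T + T') = opTensor S T + opTensor S T' := by
  refine op_ext fun x => ?_
  rw [opTensor_toHilbert, TensorProduct.mapL_add_right]
  simp [opTensor_toHilbert]

theorem opTensor_smul_left (c : ℂ) (S : H →L[ℂ] H) (T : K →L[ℂ] K) :
    opTensor (c • S) T = c • opTensor S T := by
  refine op_ext fun x => ?_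
  rw [opTensor_toHilbert, TensorProduct.mapL_smul_left]
  simp [opTensor_toHilbert]

theorem opTensor_smul_right (c : ℂ) (S : H →L[ℂ] H) (T : K →L[ℂ] K) :
    opTensor S (c • T) = c • opTensor S T := by
  refine op_ext fun x => ?_
  rw [opTensor_toHilbert, TensorProduct.mapL_smul_right]
  simp [opTensor_toHilbert]

theorem star_opTensor [CompleteSpace H] [CompleteSpace K] (S : H →L[ℂ] H) (T : K →L[ℂ] K) :
    star (opTensor S T) = opTensor (star S) (star T) := by
  symm
  rw [ContinuousLinearMap.star_eq_adjoint (opTensor S T), ContinuousLinearMap.eq_adjoint_iff]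
  intro x y
  refine denseRange_toHilbert.induction_on₂ (p := fun x y => inner ℂ
    (opTensor (star S) (star T) x) y = inner ℂ x (opTensor S T y)) ?_ ?_ x y
  · apply isClosed_eq <;> fun_prop
  · intro x y
    rw [opTensor_toHilbert, opTensor_toHilbert, inner_toHilbert, inner_toHilbert]
    induction x using TensorProduct.induction_on with
    | zero => simp
    | add x x' hx hx' => simp only [map_add, inner_add_left, hx, hx']
    | tmul a b =>
      induction y using TensorProduct.induction_on with
      | zero => simp
      | add y y' hy hy' => simp only [map_add, inner_add_right, hy, hy']
      | tmul c d =>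
        simp only [TensorProduct.mapL_tmul, TensorProduct.inner_tmul,
          ContinuousLinearMap.star_eq_adjoint, ContinuousLinearMap.adjoint_inner_left]

end HilbertTensor

/-- A unital `*`-representation of a unital C⋆-algebra on a Hilbert space. -/
structure HilbertRep (A : Type u) [CStarAlgebra A] where
  H : Type u
  [normed : NormedAddCommGroup H]
  [inner : InnerProductSpace ℂ H]
  [complete : CompleteSpace H]
  π : A →⋆ₐ[ℂ] (H →L[ℂ] H)

attribute [instance] HilbertRep.normed HilbertRep.inner HilbertRep.complete

section MinNorm

variable {A B C D : Type u} [CStarAlgebra A] [CStarAlgebra B] [CStarAlgebra C] [CStarAlgebra D]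

/-- The representation `a ↦ π(a) ⊗ 1` on `H ⊗̂ K`. -/
def leftRep (π : HilbertRep A) (K : Type u) [NormedAddCommGroup K] [InnerProductSpace ℂ K] :
    A →ₐ[ℂ] (HilbertTensor π.H K →L[ℂ] HilbertTensor π.H K) :=
  AlgHom.ofLinearMap
    { toFun := fun a => opTensor (π.π a) 1
      map_add' := fun a b => by rw [map_add, opTensor_add_left]
      map_smul' := fun c a => by rw [map_smul, opTensor_smul_left]; rfl }
    (by simp [opTensor_one])
    (fun a b => by simp [← opTensor_mul])

/-- The representation `b ↦ 1 ⊗ ρ(b)` on `H ⊗̂ K`. -/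
def rightRep (H : Type u) [NormedAddCommGroup H] [InnerProductSpace ℂ H] (ρ : HilbertRep B) :
    B →ₐ[ℂ] (HilbertTensor H ρ.H →L[ℂ] HilbertTensor H ρ.H) :=
  AlgHom.ofLinearMap
    { toFun := fun b => opTensor 1 (ρ.π b)
      map_add' := fun a b => by rw [map_add, opTensor_add_right]
      map_smul' := fun c a => by rw [map_smul, opTensor_smul_right]; rfl }
    (by simp [opTensor_one])
    (fun a b => by simp [← opTensor_mul])

theorem leftRep_apply (π : HilbertRep A) (K : Type u) [NormedAddCommGroup K]
    [InnerProductSpace ℂ K] (a : A) : leftRep π K a = opTensor (π.π a) 1 := rfl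

theorem rightRep_apply (H : Type u) [NormedAddCommGroup H] [InnerProductSpace ℂ H]
    (ρ : HilbertRep B) (b : B) : rightRep H ρ b = opTensor 1 (ρ.π b) := rfl

theorem commute_leftRep_rightRep (π : HilbertRep A) (ρ : HilbertRep B) (a : A) (b : B) :
    Commute (leftRep π ρ.H a) (rightRep π.H ρ b) := by
  rw [leftRep_apply, rightRep_apply, commute_iff_eq, ← opTensor_mul, ← opTensor_mul]
  simp only [mul_one, one_mul]

/-- The representation `a ⊗ b ↦ π(a) ⊗ ρ(b)` of the algebraic tensor product on `H ⊗̂ K`. -/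
def tensorRep (π : HilbertRep A) (ρ : HilbertRep B) :
    A ⊗[ℂ] B →ₐ[ℂ] (HilbertTensor π.H ρ.H →L[ℂ] HilbertTensor π.H ρ.H) :=
  Algebra.TensorProduct.lift (leftRep π ρ.H) (rightRep π.H ρ) (commute_leftRep_rightRep π ρ)

theorem tensorRep_tmul (π : HilbertRep A) (ρ : HilbertRep B) (a : A) (b : B) :
    tensorRep π ρ (a ⊗ₜ b) = opTensor (π.π a) (ρ.π b) := by
  rw [tensorRep, Algebra.TensorProduct.lift_tmul, leftRep_apply, rightRep_apply,
    ← opTensor_mul, mul_one, one_mul]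

theorem tensorRep_star (π : HilbertRep A) (ρ : HilbertRep B) (x : A ⊗[ℂ] B) :
    tensorRep π ρ (star x) = star (tensorRep π ρ x) := by
  induction x using TensorProduct.induction_on with
  | zero => simp
  | add x y hx hy => simp [hx, hy]
  | tmul a b => simp only [TensorProduct.star_tmul, tensorRep_tmul, map_star, star_opTensor]

/-- The minimal (spatial) C⋆-norm on the algebraic tensor product. -/
def minNorm (x : A ⊗[ℂ] B) : ℝ :=
  ⨆ r : HilbertRep A × HilbertRep B, ‖tensorRep r.1 r.2 x‖

theorem norm_tensorRep_bddAbove (x : A ⊗[ℂ] B) :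
    BddAbove (Set.range fun r : HilbertRep A × HilbertRep B => ‖tensorRep r.1 r.2 x‖) := by
  suffices h : ∃ M : ℝ, ∀ r : HilbertRep A × HilbertRep B, ‖tensorRep r.1 r.2 x‖ ≤ M by
    obtain ⟨M, hM⟩ := h
    exact ⟨M, by rintro _ ⟨r, rfl⟩; exact hM r⟩
  induction x using TensorProduct.induction_on with
  | zero => exact ⟨0, fun r => by simp⟩
  | add x y hx hy =>
    obtain ⟨M, hM⟩ := hx
    obtain ⟨N, hN⟩ := hy
    exact ⟨M + N, fun r => by
      rw [map_add]; exact (norm_add_le _ _).trans (add_le_add (hM r) (hN r))⟩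
  | tmul a b =>
    refine ⟨‖a‖ * ‖b‖, fun r => ?_⟩
    rw [tensorRep_tmul]
    refine (norm_opTensor_le _ _).trans ?_
    exact mul_le_mul (NonUnitalStarAlgHom.norm_apply_le r.1.π a)
      (NonUnitalStarAlgHom.norm_apply_le r.2.π b) (norm_nonneg _) (norm_nonneg _)

theorem le_minNorm (π : HilbertRep A) (ρ : HilbertRep B) (x : A ⊗[ℂ] B) :
    ‖tensorRep π ρ x‖ ≤ minNorm x :=
  le_ciSup (norm_tensorRep_bddAbove x) (π, ρ)

theorem minNorm_nonneg (x : A ⊗[ℂ] B) : 0 ≤ minNorm x :=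
  Real.iSup_nonneg fun _ => norm_nonneg _

theorem minNorm_le {x : A ⊗[ℂ] B} {M : ℝ} (hM : 0 ≤ M)
    (h : ∀ (π : HilbertRep A) (ρ : HilbertRep B), ‖tensorRep π ρ x‖ ≤ M) : minNorm x ≤ M :=
  Real.iSup_le (fun r => h r.1 r.2) hM

theorem minNorm_zero : minNorm (0 : A ⊗[ℂ] B) = 0 :=
  le_antisymm (minNorm_le le_rfl fun _ _ => by simp) (minNorm_nonneg _)

theorem minNorm_add (x y : A ⊗[ℂ] B) : minNorm (x + y) ≤ minNorm x + minNorm y :=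
  minNorm_le (add_nonneg (minNorm_nonneg x) (minNorm_nonneg y)) fun π ρ => by
    rw [map_add]
    exact (norm_add_le _ _).trans (add_le_add (le_minNorm π ρ x) (le_minNorm π ρ y))

theorem minNorm_neg (x : A ⊗[ℂ] B) : minNorm (-x) = minNorm x := by
  simp [minNorm]

theorem minNorm_mul (x y : A ⊗[ℂ] B) : minNorm (x * y) ≤ minNorm x * minNorm y :=
  minNorm_le (mul_nonneg (minNorm_nonneg x) (minNorm_nonneg y)) fun π ρ => by
    rw [map_mul]
    exact (norm_mul_le _ _).trans
      (mul_le_mul (le_minNorm π ρ x) (le_minNorm π ρ y) (norm_nonneg _) (minNorm_nonneg x))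

theorem minNorm_smul_le (c : ℂ) (x : A ⊗[ℂ] B) : minNorm (c • x) ≤ ‖c‖ * minNorm x :=
  minNorm_le (mul_nonneg (norm_nonneg c) (minNorm_nonneg x)) fun π ρ => by
    rw [map_smul, norm_smul]
    exact mul_le_mul_of_nonneg_left (le_minNorm π ρ x) (norm_nonneg c)

theorem minNorm_star (x : A ⊗[ℂ] B) : minNorm (star x) = minNorm x := by
  simp [minNorm, tensorRep_star]

theorem star_tensor_mul (x y : A ⊗[ℂ] B) : star (x * y) = star y * star x := by
  induction x using TensorProduct.induction_on with
  | zero => simp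
  | add x x' hx hx' => rw [add_mul, star_add, star_add, mul_add, hx, hx']
  | tmul a b =>
    induction y using TensorProduct.induction_on with
    | zero => simp
    | add y y' hy hy' => rw [mul_add, star_add, star_add, add_mul, hy, hy']
    | tmul c d => simp

theorem minNorm_le_star_mul_self (x : A ⊗[ℂ] B) :
    minNorm x * minNorm x ≤ minNorm (star x * x) := by
  have h : minNorm x ≤ √(minNorm (star x * x)) :=
    minNorm_le (Real.sqrt_nonneg _) fun π ρ => by
      refine Real.le_sqrt_of_sq_le ?_
      have := le_minNorm π ρ (star x * x)
      rw [map_mul, tensorRep_star, CStarRing.norm_star_mul_self] at this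
      rwa [sq]
  calc minNorm x * minNorm x ≤ √(minNorm (star x * x)) * √(minNorm (star x * x)) :=
        mul_le_mul h h (minNorm_nonneg x) (Real.sqrt_nonneg _)
    _ = _ := Real.mul_self_sqrt (minNorm_nonneg _)

end MinNorm

/-- The algebraic tensor product, as a `*`-algebra equipped with the minimal C⋆-norm. -/
def AlgTensor (A B : Type u) [CStarAlgebra A] [CStarAlgebra B] : Type u := A ⊗[ℂ] B

section AlgTensor

variable (A B : Type u) [CStarAlgebra A] [CStarAlgebra B]

instance : Ring (AlgTensor A B) := inferInstanceAs (Ring (A ⊗[ℂ] B))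
instance : Algebra ℂ (AlgTensor A B) := inferInstanceAs (Algebra ℂ (A ⊗[ℂ] B))

variable {A B} in
/-- The identity map of the algebraic tensor product. -/
def toAlg : A ⊗[ℂ] B ≃ₐ[ℂ] AlgTensor A B := AlgEquiv.refl

instance : StarRing (AlgTensor A B) where
  star x := toAlg (star (toAlg.symm x))
  star_involutive := star_involutive (R := A ⊗[ℂ] B)
  star_mul := star_tensor_mul
  star_add := star_add (R := A ⊗[ℂ] B)

instance : SeminormedRing (AlgTensor A B) :=
  RingSeminorm.toSeminormedRing
    { toFun := fun x : AlgTensor A B => minNorm (toAlg.symm x)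
      map_zero' := minNorm_zero
      add_le' := minNorm_add
      neg' := minNorm_neg
      mul_le' := minNorm_mul }

variable {A B} in
theorem norm_toAlg (x : A ⊗[ℂ] B) : ‖toAlg x‖ = minNorm x := rfl

variable {A B} in
theorem star_toAlg (x : A ⊗[ℂ] B) : star (toAlg x) = toAlg (star x) := rfl

instance : NormedSpace ℂ (AlgTensor A B) where
  norm_smul_le := minNorm_smul_le (A := A) (B := B)

end AlgTensor

/-- The minimal tensor product of the unital C⋆-algebras `A` and `B`: the completion of the
algebraic tensor product in the minimal C⋆-norm. -/
def MinTensor (A B : Type u) [CStarAlgebra A] [CStarAlgebra B] : Type u :=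
  UniformSpace.Completion (AlgTensor A B)

section MinTensor

open UniformSpace

variable (A B : Type u) [CStarAlgebra A] [CStarAlgebra B]

instance : NormedRing (MinTensor A B) :=
  inferInstanceAs (NormedRing (Completion (AlgTensor A B)))
instance : CompleteSpace (MinTensor A B) :=
  inferInstanceAs (CompleteSpace (Completion (AlgTensor A B)))
instance : Algebra ℂ (MinTensor A B) :=
  inferInstanceAs (Algebra ℂ (Completion (AlgTensor A B)))

variable {A B}

/-- The canonical map of the algebraic tensor product into the minimal tensor product. -/
def toMin : A ⊗[ℂ] B →ₐ[ℂ] MinTensor A B where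
  toFun x := (toAlg x : Completion (AlgTensor A B))
  map_one' := Completion.coe_one (α := AlgTensor A B)
  map_mul' := Completion.coe_mul (α := AlgTensor A B)
  map_zero' := Completion.coe_zero (α := AlgTensor A B)
  map_add' := Completion.coe_add (α := AlgTensor A B)
  commutes' _ := rfl

theorem denseRange_toMin : DenseRange (toMin : A ⊗[ℂ] B → MinTensor A B) :=
  Completion.denseRange_coe (α := AlgTensor A B)

theorem norm_toMin (x : A ⊗[ℂ] B) : ‖toMin x‖ = minNorm x :=
  Completion.norm_coe (E := AlgTensor A B) (toAlg x)

theorem uniformContinuous_star_alg :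
    UniformContinuous (star : AlgTensor A B → AlgTensor A B) := by
  refine (Isometry.of_dist_eq fun x y => ?_).uniformContinuous
  rw [dist_eq_norm, dist_eq_norm, ← star_sub]
  exact minNorm_star (A := A) (B := B) (toAlg.symm (x - y))

instance : Star (MinTensor A B) where
  star := Completion.map (star : AlgTensor A B → AlgTensor A B)

theorem star_toMin (x : A ⊗[ℂ] B) : star (toMin x) = toMin (star x) :=
  Completion.map_coe uniformContinuous_star_alg (toAlg x)

theorem continuous_star_min : Continuous (star : MinTensor A B → MinTensor A B) :=
  Completion.continuous_map

variable (A B)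

instance : StarRing (MinTensor A B) where
  star_involutive z := by
    refine denseRange_toMin.induction_on (p := fun z => star (star z) = z) z ?_ ?_
    · exact isClosed_eq (continuous_star_min.comp continuous_star_min) continuous_id
    · intro x
      rw [star_toMin, star_toMin, star_star]
  star_mul z w := by
    refine denseRange_toMin.induction_on₂ (p := fun z w => star (z * w) = star w * star z)
      ?_ ?_ z w
    · exact isClosed_eq (continuous_star_min.comp continuous_mul)
        ((continuous_star_min.comp continuous_snd).mul (continuous_star_min.comp continuous_fst))
    · intro x y
      rw [← map_mul, star_toMin, star_toMin, star_toMin, star_tensor_mul, map_mul]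
  star_add z w := by
    refine denseRange_toMin.induction_on₂ (p := fun z w => star (z + w) = star z + star w)
      ?_ ?_ z w
    · exact isClosed_eq (continuous_star_min.comp continuous_add)
        ((continuous_star_min.comp continuous_fst).add (continuous_star_min.comp continuous_snd))
    · intro x y
      rw [← map_add, star_toMin, star_toMin, star_toMin, star_add, map_add]

instance : CStarAlgebra (MinTensor A B) where
  norm_mul_self_le z := by
    refine denseRange_toMin.induction_on (p := fun z => ‖z‖ * ‖z‖ ≤ ‖star z * z‖) z ?_ ?_
    · exact isClosed_le (continuous_norm.mul continuous_norm)
        (continuous_norm.comp (continuous_star_min.mul continuous_id))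
    · intro x
      rw [star_toMin, ← map_mul, norm_toMin, norm_toMin]
      exact minNorm_le_star_mul_self x
  norm_smul_le c z := by
    refine denseRange_toMin.induction_on (p := fun z => ‖c • z‖ ≤ ‖c‖ * ‖z‖) z ?_ ?_
    · have h : Continuous fun z : MinTensor A B => c • z := by
        simp only [Algebra.smul_def]
        exact continuous_const.mul continuous_id
      exact isClosed_le (continuous_norm.comp h) (continuous_const.mul continuous_norm)
    · intro x
      rw [← map_smul, norm_toMin, norm_toMin]
      exact minNorm_smul_le c x
  star_smul c z := by
    have h : ∀ d : ℂ, Continuous fun z : MinTensor A B => d • z := fun d => by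
      simp only [Algebra.smul_def]
      exact continuous_const.mul continuous_id
    refine denseRange_toMin.induction_on (p := fun z => star (c • z) = star c • star z) z ?_ ?_
    · exact isClosed_eq (continuous_star_min.comp (h c)) ((h _).comp continuous_star_min)
    · intro x
      rw [← map_smul, star_toMin, star_toMin, star_smul, map_smul]

end MinTensor

section Functoriality

variable {A B C D : Type u} [CStarAlgebra A] [CStarAlgebra B] [CStarAlgebra C] [CStarAlgebra D]

/-- The restriction of a representation along a `*`-homomorphism. -/
abbrev HilbertRep.comp (π : HilbertRep C) (f : A →⋆ₐ[ℂ] C) : HilbertRep A where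
  H := π.H
  π := π.π.comp f

theorem minNorm_map_le (f : A →⋆ₐ[ℂ] C) (g : B →⋆ₐ[ℂ] D) (x : A ⊗[ℂ] B) :
    minNorm (Algebra.TensorProduct.map (f : A →ₐ[ℂ] C) (g : B →ₐ[ℂ] D) x) ≤ minNorm x :=
  minNorm_le (minNorm_nonneg x) fun π ρ => by
    have h : tensorRep π ρ (Algebra.TensorProduct.map (f : A →ₐ[ℂ] C) (g : B →ₐ[ℂ] D) x) =
        tensorRep (π.comp f) (ρ.comp g) x := by
      induction x using TensorProduct.induction_on with
      | zero => simp only [map_zero]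
      | add x y hx hy => rw [map_add, map_add, map_add, hx, hy]
      | tmul a b =>
        rw [Algebra.TensorProduct.map_tmul, tensorRep_tmul, tensorRep_tmul]
        rfl
    rw [h]
    exact le_minNorm _ _ x

/-- The map `f ⊗ g` on the dense algebraic tensor product. -/
def mapAlg (f : A →⋆ₐ[ℂ] C) (g : B →⋆ₐ[ℂ] D) : AlgTensor A B →ₐ[ℂ] MinTensor C D :=
  (toMin.comp (Algebra.TensorProduct.map (f : A →ₐ[ℂ] C) (g : B →ₐ[ℂ] D))).comp
    (toAlg (A := A) (B := B)).symm.toAlgHom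

theorem mapAlg_toAlg (f : A →⋆ₐ[ℂ] C) (g : B →⋆ₐ[ℂ] D) (x : A ⊗[ℂ] B) :
    mapAlg f g (toAlg x) =
      toMin (Algebra.TensorProduct.map (f : A →ₐ[ℂ] C) (g : B →ₐ[ℂ] D) x) := rfl

theorem continuous_mapAlg (f : A →⋆ₐ[ℂ] C) (g : B →⋆ₐ[ℂ] D) :
    Continuous (mapAlg f g).toRingHom := by
  refine AddMonoidHomClass.continuous_of_bound (mapAlg f g).toRingHom 1 fun x => ?_
  rw [one_mul]
  obtain ⟨y, rfl⟩ := toAlg.surjective x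
  have h := minNorm_map_le f g y
  rw [← norm_toMin, ← mapAlg_toAlg, ← norm_toAlg] at h
  exact h

theorem map_star_tensor (f : A →⋆ₐ[ℂ] C) (g : B →⋆ₐ[ℂ] D) (x : A ⊗[ℂ] B) :
    Algebra.TensorProduct.map (f : A →ₐ[ℂ] C) (g : B →ₐ[ℂ] D) (star x) =
      star (Algebra.TensorProduct.map (f : A →ₐ[ℂ] C) (g : B →ₐ[ℂ] D) x) := by
  induction x using TensorProduct.induction_on with
  | zero => simp
  | add x y hx hy => rw [star_add, map_add, map_add, star_add, hx, hy]
  | tmul a b =>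
    rw [TensorProduct.star_tmul, Algebra.TensorProduct.map_tmul, Algebra.TensorProduct.map_tmul,
      TensorProduct.star_tmul]
    exact congrArg₂ (fun c d => c ⊗ₜ[ℂ] d) (map_star f a) (map_star g b)

/-- The continuous extension of `f ⊗ g` to the minimal tensor product, as a ring homomorphism. -/
def minMapRingHom (f : A →⋆ₐ[ℂ] C) (g : B →⋆ₐ[ℂ] D) : MinTensor A B →+* MinTensor C D :=
  UniformSpace.Completion.extensionHom (mapAlg f g).toRingHom (continuous_mapAlg f g)

theorem minMapRingHom_toMin (f : A →⋆ₐ[ℂ] C) (g : B →⋆ₐ[ℂ] D) (x : A ⊗[ℂ] B) :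
    minMapRingHom f g (toMin x) =
      toMin (Algebra.TensorProduct.map (f : A →ₐ[ℂ] C) (g : B →ₐ[ℂ] D) x) :=
  UniformSpace.Completion.extensionHom_coe (mapAlg f g).toRingHom (continuous_mapAlg f g) (toAlg x)

theorem continuous_minMapRingHom (f : A →⋆ₐ[ℂ] C) (g : B →⋆ₐ[ℂ] D) :
    Continuous (minMapRingHom f g) :=
  UniformSpace.Completion.continuous_extension

/-- The `*`-homomorphism `f ⊗ g` between minimal tensor products: the continuous extension of
`a ⊗ b ↦ f a ⊗ g b`. -/
def minMap (f : A →⋆ₐ[ℂ] C) (g : B →⋆ₐ[ℂ] D) : MinTensor A B →⋆ₐ[ℂ] MinTensor C D where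
  __ := minMapRingHom f g
  commutes' c := by
    change minMapRingHom f g (algebraMap ℂ (MinTensor A B) c) = _
    rw [← AlgHom.commutes (toMin (A := A) (B := B)), minMapRingHom_toMin, AlgHom.commutes,
      AlgHom.commutes]
  map_star' z := by
    change minMapRingHom f g (star z) = star (minMapRingHom f g z)
    refine denseRange_toMin.induction_on
      (p := fun z => minMapRingHom f g (star z) = star (minMapRingHom f g z)) z ?_ ?_
    · exact isClosed_eq ((continuous_minMapRingHom f g).comp continuous_star_min)
        (continuous_star_min.comp (continuous_minMapRingHom f g))
    · intro x
      rw [star_toMin, minMapRingHom_toMin, minMapRingHom_toMin, star_toMin, map_star_tensor]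

theorem minMap_toMin (f : A →⋆ₐ[ℂ] C) (g : B →⋆ₐ[ℂ] D) (x : A ⊗[ℂ] B) :
    minMap f g (toMin x) =
      toMin (Algebra.TensorProduct.map (f : A →ₐ[ℂ] C) (g : B →ₐ[ℂ] D) x) :=
  minMapRingHom_toMin f g x

end Functoriality

section Associator

variable {A B C : Type u} [CStarAlgebra A] [CStarAlgebra B] [CStarAlgebra C]

/-- `z ∈ (A ⊗ B) ⊗ C` and `w ∈ A ⊗ (B ⊗ C)` correspond to each other under the canonical
isomorphism of iterated minimal tensor products. The graph of that isomorphism is the closure of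
the graph of the associator `(a ⊗ b) ⊗ c ↦ a ⊗ (b ⊗ c)` of the algebraic tensor products. -/
def IsAssociated (z : MinTensor (MinTensor A B) C) (w : MinTensor A (MinTensor B C)) : Prop :=
  (z, w) ∈ closure (Set.range fun x : (A ⊗[ℂ] B) ⊗[ℂ] C =>
    ((toMin (Algebra.TensorProduct.map (toMin (A := A) (B := B)) (AlgHom.id ℂ C) x),
      toMin (Algebra.TensorProduct.map (AlgHom.id ℂ A) (toMin (A := B) (B := C))
        (Algebra.TensorProduct.assoc ℂ ℂ ℂ A B C x))) :
      MinTensor (MinTensor A B) C × MinTensor A (MinTensor B C)))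

end Associator

/-! ### Compact quantum groups -/

/-- A compact quantum group `(Q, Δ)` (in the sense of Woronowicz): a coassociative unital
`*`-homomorphism `Δ : Q → Q ⊗ Q` into the minimal tensor product such that the linear spans of
`(1 ⊗ Q) Δ(Q)` and of `(Q ⊗ 1) Δ(Q)` are dense. -/
structure CompactQuantumGroup (Q : Type u) [CStarAlgebra Q] where
  Δ : Q →⋆ₐ[ℂ] MinTensor Q Q
  coassoc : ∀ a : Q, IsAssociated (minMap Δ (StarAlgHom.id ℂ Q) (Δ a))
    (minMap (StarAlgHom.id ℂ Q) Δ (Δ a))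
  dense_right : Dense (Submodule.span ℂ
    {z : MinTensor Q Q | ∃ a b : Q, z = toMin (1 ⊗ₜ[ℂ] a) * Δ b} : Set (MinTensor Q Q))
  dense_left : Dense (Submodule.span ℂ
    {z : MinTensor Q Q | ∃ a b : Q, z = toMin (a ⊗ₜ[ℂ] 1) * Δ b} : Set (MinTensor Q Q))

/-! ### Matrices over `Q`, their intertwiners and tensor operations -/

section Matrices

variable {Q : Type u} [CStarAlgebra Q] {ι κ ι' κ' : Type}

/-- The scalar matrix `T` intertwines `u` and `v`: `(T ⊗ 1) u = v (T ⊗ 1)`. -/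
def Intertwines [Fintype ι] [Fintype κ] (T : Matrix κ ι ℂ) (u : Matrix ι ι Q)
    (v : Matrix κ κ Q) : Prop :=
  T.map (algebraMap ℂ Q) * u = v * T.map (algebraMap ℂ Q)

/-- `w` is (equivalent to) a direct summand of `x`. -/
def IsSummand [Fintype ι] [Fintype κ] [DecidableEq κ] (w : Matrix κ κ Q) (x : Matrix ι ι Q) :
    Prop :=
  ∃ (T : Matrix ι κ ℂ) (S : Matrix κ ι ℂ),
    Intertwines T w x ∧ Intertwines S x w ∧ S * T = 1

/-- The direct sum `u ⊕ v`. -/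
def directSum (u : Matrix ι ι Q) (v : Matrix κ κ Q) : Matrix (ι ⊕ κ) (ι ⊕ κ) Q :=
  Matrix.fromBlocks u 0 0 v

/-- The tensor product `u ⊗ v`, with coefficients `u_{ij} v_{kl}`. -/
def tensor (u : Matrix ι ι Q) (v : Matrix κ κ Q) : Matrix (ι × κ) (ι × κ) Q :=
  Matrix.of fun p q => u p.1 q.1 * v p.2 q.2

/-- The `n`-th tensor power of `u`, with coefficients
`u_{p(0) q(0)} u_{p(1) q(1)} ⋯ u_{p(n-1) q(n-1)}`. -/
def tensorPow (n : ℕ) (u : Matrix ι ι Q) : Matrix (Fin n → ι) (Fin n → ι) Q :=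
  Matrix.of fun p q => (List.ofFn fun k => u (p k) (q k)).prod

/-- The dual (conjugate) of `u`, with coefficients `u_{ij}^*`. -/
def dual (u : Matrix ι ι Q) : Matrix ι ι Q :=
  Matrix.of fun i j => star (u i j)

theorem intertwines_iff [Fintype ι] [Fintype κ] {T : Matrix κ ι ℂ} {u : Matrix ι ι Q}
    {v : Matrix κ κ Q} :
    Intertwines T u v ↔ ∀ a j, ∑ i, T a i • u i j = ∑ b, T b j • v a b := by
  have h : ∀ a j, (T.map (algebraMap ℂ Q) * u) a j = ∑ i, T a i • u i j := fun a j => by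
    simp [Matrix.mul_apply, Algebra.smul_def]
  have h' : ∀ a j, (v * T.map (algebraMap ℂ Q)) a j = ∑ b, T b j • v a b := fun a j => by
    simp [Matrix.mul_apply, Algebra.smul_def, Algebra.commutes]
  constructor
  · intro H a j
    rw [← h, ← h']
    exact congrFun (congrFun H a) j
  · intro H
    ext a j
    rw [h, h', H]

theorem intertwines_one [Fintype ι] [DecidableEq ι] (u : Matrix ι ι Q) :
    Intertwines (1 : Matrix ι ι ℂ) u u := by
  simp [Intertwines]

theorem Intertwines.comp [Fintype ι] [Fintype κ] [Fintype ι'] {T : Matrix κ ι ℂ}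
    {S : Matrix ι' κ ℂ} {u : Matrix ι ι Q} {v : Matrix κ κ Q} {w : Matrix ι' ι' Q}
    (hS : Intertwines S v w) (hT : Intertwines T u v) : Intertwines (S * T) u w := by
  unfold Intertwines at *
  rw [Matrix.map_mul, Matrix.mul_assoc, hT, ← Matrix.mul_assoc, hS, Matrix.mul_assoc]

theorem Intertwines.directSum [Fintype ι] [Fintype κ] [Fintype ι'] [Fintype κ']
    {T : Matrix ι' ι ℂ} {S : Matrix κ' κ ℂ} {u : Matrix ι ι Q} {u' : Matrix ι' ι' Q}
    {v : Matrix κ κ Q} {v' : Matrix κ' κ' Q} (hT : Intertwines T u u')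
    (hS : Intertwines S v v') :
    Intertwines (Matrix.fromBlocks T 0 0 S) (directSum u v) (directSum u' v') := by
  unfold Intertwines CQG.directSum at *
  rw [Matrix.fromBlocks_map, Matrix.fromBlocks_multiply, Matrix.fromBlocks_multiply]
  simp [hT, hS, Matrix.map_zero]

theorem Intertwines.tensor [Fintype ι] [Fintype κ] [Fintype ι'] [Fintype κ']
    {T : Matrix ι' ι ℂ} {S : Matrix κ' κ ℂ} {u : Matrix ι ι Q} {u' : Matrix ι' ι' Q}
    {v : Matrix κ κ Q} {v' : Matrix κ' κ' Q} (hT : Intertwines T u u')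
    (hS : Intertwines S v v') :
    Intertwines (Matrix.kroneckerMap (· * ·) T S) (tensor u v) (tensor u' v') := by
  rw [intertwines_iff] at *
  rintro ⟨a, b⟩ ⟨j, l⟩
  have h := congrArg₂ (· * ·) (hT a j) (hS b l)
  simp only [Finset.sum_mul_sum, smul_mul_smul_comm] at h
  simpa [CQG.tensor, Fintype.sum_prod_type] using h

/-- Equivalence of matrices over `Q` through an invertible intertwiner. -/
def Equivalent [Fintype ι] [Fintype κ] [DecidableEq ι] [DecidableEq κ] (u : Matrix ι ι Q)
    (v : Matrix κ κ Q) : Prop :=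
  ∃ (T : Matrix κ ι ℂ) (S : Matrix ι κ ℂ),
    Intertwines T u v ∧ Intertwines S v u ∧ S * T = 1 ∧ T * S = 1

section Equivalent

variable [Fintype ι] [Fintype κ] [DecidableEq ι] [DecidableEq κ]
  [Fintype ι'] [Fintype κ'] [DecidableEq ι'] [DecidableEq κ']

theorem Equivalent.refl (u : Matrix ι ι Q) : Equivalent u u :=
  ⟨1, 1, intertwines_one u, intertwines_one u, by simp, by simp⟩

theorem Equivalent.symm {u : Matrix ι ι Q} {v : Matrix κ κ Q} (h : Equivalent u v) :
    Equivalent v u := by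
  obtain ⟨T, S, hT, hS, h1, h2⟩ := h
  exact ⟨S, T, hS, hT, h2, h1⟩

theorem Equivalent.trans {u : Matrix ι ι Q} {v : Matrix κ κ Q} {w : Matrix ι' ι' Q}
    (h : Equivalent u v) (h' : Equivalent v w) : Equivalent u w := by
  obtain ⟨T, S, hT, hS, h1, h2⟩ := h
  obtain ⟨T', S', hT', hS', h1', h2'⟩ := h'
  refine ⟨T' * T, S * S', hT'.comp hT, hS.comp hS', ?_, ?_⟩
  · rw [Matrix.mul_assoc, ← Matrix.mul_assoc S', h1', Matrix.one_mul, h1]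
  · rw [Matrix.mul_assoc, ← Matrix.mul_assoc T, h2, Matrix.one_mul, h2']

theorem Equivalent.directSum {u : Matrix ι ι Q} {u' : Matrix ι' ι' Q} {v : Matrix κ κ Q}
    {v' : Matrix κ' κ' Q} (h : Equivalent u u') (h' : Equivalent v v') :
    Equivalent (directSum u v) (directSum u' v') := by
  obtain ⟨T, S, hT, hS, h1, h2⟩ := h
  obtain ⟨T', S', hT', hS', h1', h2'⟩ := h'
  refine ⟨_, _, hT.directSum hT', hS.directSum hS', ?_, ?_⟩ <;>
  simp [Matrix.fromBlocks_multiply, h1, h2, h1', h2']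

theorem Equivalent.tensor {u : Matrix ι ι Q} {u' : Matrix ι' ι' Q} {v : Matrix κ κ Q}
    {v' : Matrix κ' κ' Q} (h : Equivalent u u') (h' : Equivalent v v') :
    Equivalent (tensor u v) (tensor u' v') := by
  obtain ⟨T, S, hT, hS, h1, h2⟩ := h
  obtain ⟨T', S', hT', hS', h1', h2'⟩ := h'
  refine ⟨_, _, hT.tensor hT', hS.tensor hS', ?_, ?_⟩
  · rw [← Matrix.mul_kronecker_mul, h1, h1', Matrix.one_kronecker_one]
  · rw [← Matrix.mul_kronecker_mul, h2, h2', Matrix.one_kronecker_one]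

theorem Equivalent.of_equiv {u : Matrix ι ι Q} {v : Matrix κ κ Q} (e : ι ≃ κ)
    (h : ∀ i j, v (e i) (e j) = u i j) : Equivalent u v := by
  refine ⟨Matrix.of fun a i => if a = e i then 1 else 0,
    Matrix.of fun i a => if a = e i then 1 else 0, ?_, ?_, ?_, ?_⟩
  · rw [intertwines_iff]
    intro a j
    obtain ⟨i, rfl⟩ := e.surjective a
    simp [h, e.injective.eq_iff]
  · rw [intertwines_iff]
    intro i b
    obtain ⟨j, rfl⟩ := e.surjective b
    simp [h, e.injective.eq_iff]
  · ext i j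
    simp [Matrix.mul_apply, Matrix.one_apply, e.injective.eq_iff, eq_comm]
  · ext a b
    obtain ⟨i, rfl⟩ := e.surjective a
    obtain ⟨j, rfl⟩ := e.surjective b
    simp [Matrix.mul_apply, Matrix.one_apply, e.injective.eq_iff]

end Equivalent

end Matrices

/-! ### Representations -/

section Representations

variable {Q : Type u} [CStarAlgebra Q]

/-- A finite-dimensional unitary representation of `G`, written in an orthonormal basis indexed by
`ι`: a unitary matrix `u` over `Q` with `Δ(u_{ij}) = ∑ r, u_{ir} ⊗ u_{rj}`. -/
structure FinRep (G : CompactQuantumGroup Q) where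
  ι : Type
  [fintype : Fintype ι]
  [decEq : DecidableEq ι]
  mat : Matrix ι ι Q
  mem_unitary : mat ∈ unitary (Matrix ι ι Q)
  comul : ∀ i j, G.Δ (mat i j) = ∑ r, toMin (mat i r ⊗ₜ[ℂ] mat r j)

attribute [instance] FinRep.fintype FinRep.decEq

variable {G : CompactQuantumGroup Q}

namespace FinRep

/-- The zero-dimensional representation. -/
def zero (G : CompactQuantumGroup Q) : FinRep G where
  ι := Empty
  mat := 1
  mem_unitary := one_mem _
  comul i := i.elim

/-- The trivial representation. -/
def trivial (G : CompactQuantumGroup Q) : FinRep G where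
  ι := Unit
  mat := 1
  mem_unitary := one_mem _
  comul i j := by
    simp only [Matrix.one_apply_eq, Finset.univ_unique, Finset.sum_singleton, map_one]
    rw [← Algebra.TensorProduct.one_def, map_one]

/-- The direct sum of representations. -/
def add (u v : FinRep G) : FinRep G where
  ι := u.ι ⊕ v.ι
  mat := directSum u.mat v.mat
  mem_unitary := by
    have hu := Unitary.mem_iff.1 u.mem_unitary
    have hv := Unitary.mem_iff.1 v.mem_unitary
    rw [Matrix.star_eq_conjTranspose] at hu hv
    rw [Unitary.mem_iff, Matrix.star_eq_conjTranspose, directSum, Matrix.fromBlocks_conjTranspose,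
      Matrix.fromBlocks_multiply, Matrix.fromBlocks_multiply]
    simp [hu.1, hu.2, hv.1, hv.2]
  comul := by
    rintro (i | i) (j | j) <;> simp [directSum, u.comul, v.comul]

/-- The tensor product of representations. -/
def mul (u v : FinRep G) : FinRep G where
  ι := u.ι × v.ι
  mat := tensor u.mat v.mat
  mem_unitary := by
    have hu := Unitary.mem_iff.1 u.mem_unitary
    have hv := Unitary.mem_iff.1 v.mem_unitary
    rw [Unitary.mem_iff]
    constructor
    · ext ⟨i, k⟩ ⟨j, l⟩
      have h1 : ∑ a, star (u.mat a i) * u.mat a j = (1 : Matrix u.ι u.ι Q) i j := by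
        rw [← hu.1]; simp [Matrix.mul_apply, Matrix.star_apply]
      have h2 : ∑ b, star (v.mat b k) * v.mat b l = (1 : Matrix v.ι v.ι Q) k l := by
        rw [← hv.1]; simp [Matrix.mul_apply, Matrix.star_apply]
      have h3 : ∀ b, ∑ a, star (u.mat a i * v.mat b k) * (u.mat a j * v.mat b l) =
          star (v.mat b k) * (1 : Matrix u.ι u.ι Q) i j * v.mat b l := fun b => by
        rw [← h1, Finset.mul_sum, Finset.sum_mul]
        exact Finset.sum_congr rfl fun a _ => by simp [mul_assoc]
      simp only [Matrix.mul_apply, Matrix.star_apply, tensor, Matrix.of_apply,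
        Fintype.sum_prod_type_right, h3]
      by_cases hij : i = j
      · subst hij
        simp [h2, Matrix.one_apply]
      · simp [hij]
    · ext ⟨i, k⟩ ⟨j, l⟩
      have h1 : ∑ a, u.mat i a * star (u.mat j a) = (1 : Matrix u.ι u.ι Q) i j := by
        rw [← hu.2]; simp [Matrix.mul_apply, Matrix.star_apply]
      have h2 : ∑ b, v.mat k b * star (v.mat l b) = (1 : Matrix v.ι v.ι Q) k l := by
        rw [← hv.2]; simp [Matrix.mul_apply, Matrix.star_apply]
      have h3 : ∀ a, ∑ b, (u.mat i a * v.mat k b) * star (u.mat j a * v.mat l b) =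
          u.mat i a * (1 : Matrix v.ι v.ι Q) k l * star (u.mat j a) := fun a => by
        rw [← h2, Finset.mul_sum, Finset.sum_mul]
        exact Finset.sum_congr rfl fun b _ => by simp [mul_assoc]
      simp only [Matrix.mul_apply, Matrix.star_apply, tensor, Matrix.of_apply,
        Fintype.sum_prod_type, h3]
      by_cases hkl : k = l
      · subst hkl
        simp [h1, Matrix.one_apply]
      · simp [hkl]
  comul := by
    rintro ⟨i, k⟩ ⟨j, l⟩
    simp only [tensor, Matrix.of_apply, map_mul, u.comul, v.comul, Fintype.sum_prod_type,
      Finset.sum_mul_sum, ← Algebra.TensorProduct.tmul_mul_tmul]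

instance setoid (G : CompactQuantumGroup Q) : Setoid (FinRep G) where
  r u v := Equivalent u.mat v.mat
  iseqv := ⟨fun u => .refl u.mat, fun h => h.symm, fun h h' => h.trans h'⟩

/-- `u` is irreducible: it is nonzero and every subrepresentation of `u` (a representation `w` with
an injective intertwiner into `u`) is zero or all of `u`. -/
def IsIrreducible (u : FinRep G) : Prop :=
  Nonempty u.ι ∧ ∀ (w : FinRep G) (T : Matrix u.ι w.ι ℂ), Intertwines T w.mat u.mat →
    Function.Injective T.mulVec → IsEmpty w.ι ∨ Function.Surjective T.mulVec

/-- `u` is a torsion representation: up to equivalence, only finitely many irreducible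
representations occur as direct summands of the tensor powers of `u ⊕ u^*`. -/
def IsTorsion (u : FinRep G) : Prop :=
  {c : Quotient (setoid G) | ∃ w : FinRep G, ⟦w⟧ = c ∧ w.IsIrreducible ∧
    ∃ n : ℕ, IsSummand w.mat (tensorPow n (directSum u.mat (dual u.mat)))}.Finite

end FinRep

/-- The semiring of equivalence classes of finite-dimensional representations of `G`, with direct
sum as addition and tensor product as multiplication. -/
def RepClass (G : CompactQuantumGroup Q) : Type (max 1 u) := Quotient (FinRep.setoid G)

namespace RepClass

/-- The equivalence class of a representation. -/
def mk (u : FinRep G) : RepClass G := Quotient.mk _ u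

theorem sound {u v : FinRep G} (h : Equivalent u.mat v.mat) : mk u = mk v := Quotient.sound h

theorem sound_equiv {u v : FinRep G} (e : u.ι ≃ v.ι)
    (h : ∀ i j, v.mat (e i) (e j) = u.mat i j) : mk u = mk v :=
  sound (.of_equiv e h)

instance : Zero (RepClass G) := ⟨mk (FinRep.zero G)⟩
instance : One (RepClass G) := ⟨mk (FinRep.trivial G)⟩
instance : Add (RepClass G) :=
  ⟨Quotient.map₂ FinRep.add fun _ _ h _ _ h' => Equivalent.directSum h h'⟩
instance : Mul (RepClass G) :=
  ⟨Quotient.map₂ FinRep.mul fun _ _ h _ _ h' => Equivalent.tensor h h'⟩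

theorem zero_def : (0 : RepClass G) = mk (FinRep.zero G) := rfl
theorem one_def : (1 : RepClass G) = mk (FinRep.trivial G) := rfl
theorem mk_add (u v : FinRep G) : mk u + mk v = mk (u.add v) := rfl
theorem mk_mul (u v : FinRep G) : mk u * mk v = mk (u.mul v) := rfl

theorem ind {p : RepClass G → Prop} (h : ∀ u, p (mk u)) (c : RepClass G) : p c :=
  Quotient.ind h c

protected theorem zero_add (a : RepClass G) : 0 + a = a := by
  induction a using ind with | h u =>
  exact sound_equiv (Equiv.emptySum Empty u.ι) (by rintro (i | i) (j | j) <;> first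
    | exact i.elim | exact j.elim | rfl)

protected theorem add_comm (a b : RepClass G) : a + b = b + a := by
  induction a using ind with | h u =>
  induction b using ind with | h v =>
  exact sound_equiv (Equiv.sumComm u.ι v.ι) (by rintro (i | i) (j | j) <;> rfl)

protected theorem add_assoc (a b c : RepClass G) : a + b + c = a + (b + c) := by
  induction a using ind with | h u =>
  induction b using ind with | h v =>
  induction c using ind with | h w =>
  exact sound_equiv (Equiv.sumAssoc u.ι v.ι w.ι) (by
    rintro ((i | i) | i) ((j | j) | j) <;> rfl)

protected theorem mul_assoc (a b c : RepClass G) : a * b * c = a * (b * c) := by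
  induction a using ind with | h u =>
  induction b using ind with | h v =>
  induction c using ind with | h w =>
  exact sound_equiv (Equiv.prodAssoc u.ι v.ι w.ι) (by
    rintro ⟨⟨i, j⟩, k⟩ ⟨⟨i', j'⟩, k'⟩
    exact (mul_assoc (u.mat i i') (v.mat j j') (w.mat k k')).symm)

protected theorem one_mul (a : RepClass G) : 1 * a = a := by
  induction a using ind with | h u =>
  exact sound_equiv (Equiv.punitProd u.ι) (by
    rintro ⟨⟨⟩, i⟩ ⟨⟨⟩, j⟩
    exact (one_mul (u.mat i j)).symm)

protected theorem mul_one (a : RepClass G) : a * 1 = a := by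
  induction a using ind with | h u =>
  exact sound_equiv (Equiv.prodPUnit u.ι) (by
    rintro ⟨i, ⟨⟩⟩ ⟨j, ⟨⟩⟩
    exact (mul_one (u.mat i j)).symm)

protected theorem zero_mul (a : RepClass G) : 0 * a = 0 := by
  induction a using ind with | h u =>
  exact sound_equiv (u := (FinRep.zero G).mul u) (v := FinRep.zero G)
    (Equiv.equivOfIsEmpty (Empty × u.ι) Empty) (fun i => i.1.elim)

protected theorem mul_zero (a : RepClass G) : a * 0 = 0 := by
  induction a using ind with | h u =>
  exact sound_equiv (u := u.mul (FinRep.zero G)) (v := FinRep.zero G)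
    (Equiv.equivOfIsEmpty (u.ι × Empty) Empty) (fun i => i.2.elim)

protected theorem add_mul (a b c : RepClass G) : (a + b) * c = a * c + b * c := by
  induction a using ind with | h u =>
  induction b using ind with | h v =>
  induction c using ind with | h w =>
  exact sound_equiv (Equiv.sumProdDistrib u.ι v.ι w.ι) (by
    rintro ⟨(i | i), k⟩ ⟨(j | j), l⟩ <;>
    first | rfl | exact (zero_mul (w.mat k l)).symm)

protected theorem mul_add (a b c : RepClass G) : a * (b + c) = a * b + a * c := by
  induction a using ind with | h u =>
  induction b using ind with | h v =>
  induction c using ind with | h w =>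
  exact sound_equiv (Equiv.prodSumDistrib u.ι v.ι w.ι) (by
    rintro ⟨k, (i | i)⟩ ⟨l, (j | j)⟩ <;>
    first | rfl | exact (mul_zero (u.mat k l)).symm)

instance : Semiring (RepClass G) where
  add_assoc := RepClass.add_assoc
  zero_add := RepClass.zero_add
  add_zero a := by rw [RepClass.add_comm, RepClass.zero_add]
  add_comm := RepClass.add_comm
  nsmul := nsmulRec
  left_distrib := RepClass.mul_add
  right_distrib := RepClass.add_mul
  zero_mul := RepClass.zero_mul
  mul_zero := RepClass.mul_zero
  mul_assoc := RepClass.mul_assoc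
  one_mul := RepClass.one_mul
  mul_one := RepClass.mul_one

end RepClass

/-- The fusion ring `Rep G`: the Grothendieck ring `ℤ ⊗_ℕ (RepClass G)` of the semiring of
equivalence classes of finite-dimensional representations. -/
def FusionRing (G : CompactQuantumGroup Q) : Type (max 1 u) := ℤ ⊗[ℕ] RepClass G

instance : Semiring (FusionRing G) := inferInstanceAs (Semiring (ℤ ⊗[ℕ] RepClass G))

/-- The element `n • [c]` of the fusion ring. -/
def FusionRing.mk (n : ℤ) (c : RepClass G) : FusionRing G := n ⊗ₜ[ℕ] c

instance : Neg (FusionRing G) := ⟨fun x => FusionRing.mk (-1) 1 * x⟩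

theorem FusionRing.mk_neg_one_add_one : FusionRing.mk (-1) (1 : RepClass G) + 1 = 0 := by
  have h : ((-1 : ℤ) ⊗ₜ[ℕ] (1 : RepClass G) : ℤ ⊗[ℕ] RepClass G) + 1 = 0 := by
    rw [Algebra.TensorProduct.one_def, ← TensorProduct.add_tmul]
    simp
  exact h

theorem FusionRing.neg_add_cancel (x : FusionRing G) : -x + x = 0 := by
  change FusionRing.mk (-1) 1 * x + x = 0
  rw [← add_one_mul, FusionRing.mk_neg_one_add_one, zero_mul]

instance : Ring (FusionRing G) where
  zsmul := zsmulRec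
  neg_add_cancel := FusionRing.neg_add_cancel

namespace CompactQuantumGroup

variable (G)

/-- The set of matrix coefficients of finite-dimensional representations of `G`. -/
def coefficients : Set Q := {x | ∃ (u : FinRep G) (i j : u.ι), u.mat i j = x}

/-- The algebra `Q_G`: the linear span of the matrix coefficients of representations of `G`. -/
def coefAlgebra : Subalgebra ℂ Q :=
  (Submodule.span ℂ G.coefficients).toSubalgebra
    (Submodule.subset_span ⟨FinRep.trivial G, (), (), by simp [FinRep.trivial]⟩)
    (fun x y hx hy => by
      induction hx, hy using Submodule.span_induction₂ with
      | mem_mem x y hx hy =>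
        obtain ⟨u, i, j, rfl⟩ := hx
        obtain ⟨v, k, l, rfl⟩ := hy
        exact Submodule.subset_span ⟨u.mul v, (i, k), (j, l), rfl⟩
      | zero_left y _ => simp
      | zero_right x _ => simp
      | add_left x y z _ _ _ h h' => rw [add_mul]; exact add_mem h h'
      | add_right x y z _ _ _ h h' => rw [mul_add]; exact add_mem h h'
      | smul_left c x y _ _ h => rw [smul_mul_assoc]; exact Submodule.smul_mem _ c h
      | smul_right c x y _ _ h => rw [mul_smul_comm]; exact Submodule.smul_mem _ c h)

/-- `G` is irreducible: `Q_G` is a (possibly noncommutative) domain. -/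
def IsIrreducible : Prop := IsDomain G.coefAlgebra

/-- `G` is weakly irreducible: the fusion ring `Rep G` is a (possibly noncommutative) domain. -/
def IsWeaklyIrreducible : Prop := IsDomain (FusionRing G)

/-- `G` is connected: it has no nontrivial torsion irreducible representation. -/
def IsConnected : Prop :=
  ∀ u : FinRep G, u.IsIrreducible → u.IsTorsion → Equivalent u.mat (FinRep.trivial G).mat

end CompactQuantumGroup

end Representations

end

end CQG

namespace CQG

noncomputable section

open scoped TensorProduct ComplexOrder
open Filter Topology

universe u

/-! Irreducible implies weakly irreducible. The character of a representation is additive,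
multiplicative and invariant under equivalence, so it induces a ring homomorphism from the fusion
ring to the coefficient algebra. A ring embedded in a domain is a domain, so it suffices that this
map is injective. Let `h` be a Haar state, that is, (h ⊗ id)Δ(a) = h(a)1. The operator B ↦ (id ⊗
h)(u*(B ⊗ 1)z) is then a projection onto Hom(z, u), and computing its trace on matrix units gives
dim Hom(z, u) = h(χ_u* χ_z) (`homDim_eq_haar`). Hence the character determines all multiplicities.
By complete reducibility and Schur's lemma these determine the class (`ext_homDim`), and every
element of the fusion ring is a difference of two classes. Faithfulness of `h` plays no role.

The Haar state is built from scratch. Cesàro means of the convolution powers of a state ω accumulate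
at a state h with h * ω = ω * h = h. Invariance under ω passes to every positive functional
dominated by ω (`conv_eq_of_le`), and finitely many functionals are dominated by their sum. Weak-*
compactness of the state space then gives a state invariant under all positive functionals at once.
This rests on GNS representations, product functionals and slice maps for the minimal tensor
product.

Weakly irreducible implies connected. If `u` is torsion, the powers of [u] lie in the ℤ-span of
finitely many irreducible classes, so [u] is integral over ℤ. The dimension is an augmentation of
the fusion ring to ℤ, and in a domain with such an augmentation an integral element x equals the
integer ε(x) (`eq_intCast_of_isIntegral`). Thus [u] = (dim u)·1, the trivial representation occurs
in `u`, and an irreducible `u` is trivial by Schur's lemma. -/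

/-- A positive linear functional on a C⋆-algebra. -/
structure PosFun (A : Type u) [CStarAlgebra A] where
  toCLM : A →L[ℂ] ℂ
  nonneg' : ∀ a, 0 ≤ toCLM (star a * a)

/-! ### Positive functionals, GNS vectors and separation -/

namespace PosFun

variable {A B : Type u} [CStarAlgebra A] [CStarAlgebra B]

instance : FunLike (PosFun A) A ℂ where
  coe f := f.toCLM
  coe_injective f g h := by
    cases f; cases g
    simp only [mk.injEq]
    exact DFunLike.coe_injective h

instance : ContinuousLinearMapClass (PosFun A) ℂ A ℂ where
  map_add f := f.toCLM.map_add
  map_smulₛₗ f := f.toCLM.map_smul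
  map_continuous f := f.toCLM.continuous

@[simp] theorem coe_mk (f : A →L[ℂ] ℂ) (h) (a : A) : (⟨f, h⟩ : PosFun A) a = f a := rfl

@[simp] theorem toCLM_apply (f : PosFun A) (a : A) : f.toCLM a = f a := rfl

@[ext] theorem ext {f g : PosFun A} (h : ∀ a, f a = g a) : f = g := DFunLike.ext _ _ h

theorem nonneg (f : PosFun A) (a : A) : 0 ≤ f (star a * a) := f.nonneg' a

instance : Add (PosFun A) :=
  ⟨fun f g => ⟨f.toCLM + g.toCLM, fun a => add_nonneg (f.nonneg a) (g.nonneg a)⟩⟩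

theorem add_apply (f g : PosFun A) (a : A) : (f + g) a = f a + g a := rfl

/-- A positive functional is a vector functional of some representation. -/
theorem exists_gns (f : PosFun A) :
    ∃ (π : HilbertRep A) (ξ : π.H), ∀ a, f a = inner ℂ ξ (π.π a ξ) := by
  let _ := CStarAlgebra.spectralOrder A
  have _ := CStarAlgebra.spectralOrderedRing A
  have hpos : ∀ a : A, 0 ≤ a → 0 ≤ f a := fun a ha => by
    obtain ⟨b, rfl⟩ := CStarAlgebra.nonneg_iff_eq_star_mul_self.1 ha
    exact f.nonneg b
  let F : A →ₚ[ℂ] ℂ := PositiveLinearMap.mk₀ (f.toCLM : A →ₗ[ℂ] ℂ) hpos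
  refine ⟨{ H := F.GNS, π := F.gnsStarAlgHom }, ((F.toPreGNS 1 : F.PreGNS) : F.GNS), fun a => ?_⟩
  change f a = inner ℂ ((F.toPreGNS 1 : F.PreGNS) : F.GNS)
    (F.gnsNonUnitalStarAlgHom a ((F.toPreGNS 1 : F.PreGNS) : F.GNS))
  rw [PositiveLinearMap.gnsNonUnitalStarAlgHom_apply_coe, UniformSpace.Completion.inner_coe,
    PositiveLinearMap.preGNS_inner_def]
  simp
  rfl

theorem map_star (f : PosFun A) (a : A) : f (star a) = star (f a) := by
  obtain ⟨π, ξ, h⟩ := f.exists_gns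
  rw [h, h, StarHomClass.map_star, ContinuousLinearMap.star_eq_adjoint,
    ContinuousLinearMap.adjoint_inner_right]
  exact (inner_conj_symm _ _).symm

theorem norm_apply_le (f : PosFun A) (a : A) : ‖f a‖ ≤ ‖f 1‖ * ‖a‖ := by
  obtain ⟨π, ξ, h⟩ := f.exists_gns
  have h1 : ‖f 1‖ = ‖ξ‖ * ‖ξ‖ := by
    rw [h, map_one, one_apply_eq_self, inner_self_eq_norm_sq_to_K]
    simp [sq]
  rw [h1, h]
  calc ‖inner ℂ ξ (π.π a ξ)‖ ≤ ‖ξ‖ * ‖π.π a ξ‖ := norm_inner_le_norm _ _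
    _ ≤ ‖ξ‖ * (‖a‖ * ‖ξ‖) := by
        gcongr
        exact ((π.π a).le_opNorm ξ).trans
          (mul_le_mul_of_nonneg_right (NonUnitalStarAlgHom.norm_apply_le π.π a) (norm_nonneg _))
    _ = _ := by ring

/-- In the GNS picture f(d*d) = ‖π(d)ξ‖², so its vanishing means π(d)ξ = 0. This is the
Cauchy–Schwarz step in `conv_eq_of_le`. -/
theorem map_mul_eq_zero (f : PosFun A) {d : A} (h : f (star d * d) = 0) (c : A) :
    f (c * d) = 0 := by
  obtain ⟨π, ξ, hf⟩ := f.exists_gns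
  have hd : π.π d ξ = 0 := by
    rw [hf, map_mul, StarHomClass.map_star, ContinuousLinearMap.star_eq_adjoint,
      mul_apply_eq_comp, ContinuousLinearMap.adjoint_inner_right] at h
    exact inner_self_eq_zero.1 h
  rw [hf, map_mul, mul_apply_eq_comp, hd, map_zero, inner_zero_right]

/-- Hahn–Banach separation of `a` from the closed convex cone of positive elements, followed by
complexification of the real functional obtained. -/
theorem exists_of_not_nonneg {a : A} (ha : IsSelfAdjoint a)
    (h : ¬ (∃ b : A, a = star b * b)) : ∃ f : PosFun A, (f a).re < 0 := by
  let _ := CStarAlgebra.spectralOrder A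
  have _ := CStarAlgebra.spectralOrderedRing A
  have h : ¬ 0 ≤ a := fun h' => h (CStarAlgebra.nonneg_iff_eq_star_mul_self.1 h')
  let C : ProperCone ℝ A :=
    { PointedCone.positive ℝ A with
      isClosed' := by exact CStarAlgebra.isClosed_nonneg }
  have hC : ∀ x : A, x ∈ C ↔ 0 ≤ x := fun x => Iff.rfl
  obtain ⟨g, hg, hga⟩ := C.hyperplane_separation_point (x₀ := a) (fun h' => h ((hC a).1 h'))
  let s : A →L[ℝ] A := ((starL' ℝ : A ≃L[ℝ] A) : A →L[ℝ] A)
  have hs : ∀ x, s x = star x := fun x => rfl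
  -- Symmetrising under the involution makes the functional vanish on skew-adjoint elements, so its
  -- complex extension is real on self-adjoint ones, where it equals 2g.
  let g' : A →L[ℝ] ℝ := g + g.comp s
  have hg' : ∀ x, g' x = g x + g (star x) := fun x => rfl
  let F : A →L[ℂ] ℂ := StrongDual.extendRCLike (𝕜 := ℂ) g'
  have hF : ∀ x, F x = (g' x : ℂ) - Complex.I * (g' (Complex.I • x) : ℂ) := fun x =>
    StrongDual.extendRCLike_apply (𝕜 := ℂ) g' x
  have hsa : ∀ x, IsSelfAdjoint x → F x = ((2 * g x : ℝ) : ℂ) := fun x hx => by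
    have h0 : g' (Complex.I • x) = 0 := by
      rw [hg', star_smul, hx.star_eq]
      simp
    rw [hF, h0, hg', hx.star_eq]
    push_cast
    ring
  refine ⟨⟨F, fun x => ?_⟩, ?_⟩
  · rw [hsa _ (.star_mul_self x)]
    have := hg (star x * x) ((hC _).2 (star_mul_self_nonneg x))
    exact_mod_cast (by positivity)
  · rw [coe_mk, hsa _ ha, Complex.ofReal_re]
    linarith

/-- If every positive functional kills a self-adjoint `b`, then neither `b` nor `-b` can be
separated from the positive cone, so b = 0. The general case follows by taking real and imaginary
parts. -/
theorem separating {a : A} (h : ∀ f : PosFun A, f a = 0) : a = 0 := by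
  have key : ∀ b : A, IsSelfAdjoint b → (∀ f : PosFun A, f b = 0) → b = 0 := fun b hb hf => by
    let _ := CStarAlgebra.spectralOrder A
    have _ := CStarAlgebra.spectralOrderedRing A
    have h1 : ∀ c : A, IsSelfAdjoint c → (∀ f : PosFun A, f c = 0) → 0 ≤ c := fun c hc hf => by
      rw [CStarAlgebra.nonneg_iff_eq_star_mul_self]
      by_contra h'
      obtain ⟨f, hfc⟩ := exists_of_not_nonneg hc h'
      simp [hf f] at hfc
    refine le_antisymm ?_ (h1 b hb hf)
    exact neg_nonneg.1 (h1 (-b) hb.neg fun f => by rw [map_neg, hf, neg_zero])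
  have h1 : a + star a = 0 := key _ (IsSelfAdjoint.add_star_self a) fun f => by
    rw [map_add, map_star, h, star_zero, add_zero]
  have h2 : Complex.I • (a - star a) = 0 := key _ (by
      rw [IsSelfAdjoint, star_smul, star_sub, star_star]
      simp only [smul_sub, Complex.star_def, Complex.conj_I, neg_smul]
      abel) fun f => by
    rw [map_smul, map_sub, map_star, h]; simp
  have h3 : a = star a := sub_eq_zero.1 ((smul_eq_zero.1 h2).resolve_left Complex.I_ne_zero)
  rw [← h3, ← two_smul ℂ a] at h1
  exact (smul_eq_zero.1 h1).resolve_left two_ne_zero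

/-- An element acting in every representation with bound `M` has norm at most `M`. -/
theorem norm_le_of_rep {q : A} {M : ℝ} (hM : 0 ≤ M)
    (h : ∀ (π : HilbertRep A) (η : π.H), ‖π.π q η‖ ≤ M * ‖η‖) : ‖q‖ ≤ M := by
  let _ := CStarAlgebra.spectralOrder A
  have _ := CStarAlgebra.spectralOrderedRing A
  have h1 : star q * q ≤ algebraMap ℝ A (M * M) := by
    rw [← sub_nonneg, CStarAlgebra.nonneg_iff_eq_star_mul_self]
    -- Otherwise some positive functional is negative on M² − q*q, and its GNS vector η violates
    -- ‖π(q)η‖ ≤ M‖η‖.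
    by_contra h'
    obtain ⟨f, hf⟩ := exists_of_not_nonneg
      (((IsSelfAdjoint.all (M * M)).algebraMap A).sub (IsSelfAdjoint.star_mul_self q)) h'
    obtain ⟨π, η, hη⟩ := f.exists_gns
    have e1 : f (star q * q) = ((‖π.π q η‖ ^ 2 : ℝ) : ℂ) := by
      rw [hη, map_mul, StarHomClass.map_star, ContinuousLinearMap.star_eq_adjoint,
        mul_apply_eq_comp, ContinuousLinearMap.adjoint_inner_right,
        inner_self_eq_norm_sq_to_K]
      simp
    have e2 : f (algebraMap ℝ A (M * M)) = ((M * M * ‖η‖ ^ 2 : ℝ) : ℂ) := by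
      rw [IsScalarTower.algebraMap_apply ℝ ℂ A, Algebra.algebraMap_eq_smul_one, map_smul, hη,
        map_one, one_apply_eq_self, inner_self_eq_norm_sq_to_K]
      simp
    rw [map_sub, e1, e2, ← Complex.ofReal_sub, Complex.ofReal_re] at hf
    have := pow_le_pow_left₀ (norm_nonneg _) (h π η) 2
    nlinarith
  have h2 := (CStarAlgebra.norm_le_iff_le_algebraMap (star q * q) (mul_nonneg hM hM)
    (star_mul_self_nonneg q)).2 h1
  rw [CStarRing.norm_star_mul_self] at h2
  exact abs_le_of_sq_le_sq' (by nlinarith) hM |>.2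

end PosFun

/-! ### Continuous linear maps on the minimal tensor product -/

section Extension

variable {A B : Type u} [CStarAlgebra A] [CStarAlgebra B] {E : Type*} [NormedAddCommGroup E]
  [NormedSpace ℂ E]

theorem continuous_linear_ext {S T : MinTensor A B →L[ℂ] E}
    (h : ∀ a b, S (toMin (a ⊗ₜ b)) = T (toMin (a ⊗ₜ b))) : S = T := by
  ext x
  refine denseRange_toMin.induction_on (p := fun x => S x = T x) x
    (isClosed_eq S.continuous T.continuous) fun y => ?_
  induction y using TensorProduct.induction_on with
  | zero => simp
  | add y z hy hz => simp only [map_add, hy, hz]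
  | tmul a b => exact h a b

variable [CompleteSpace E]

theorem exists_extension (L : A ⊗[ℂ] B →ₗ[ℂ] E) (C : ℝ) (h : ∀ x, ‖L x‖ ≤ C * minNorm x) :
    ∃ T : MinTensor A B →L[ℂ] E, ∀ x, T (toMin x) = L x := by
  let e : A ⊗[ℂ] B →ₗ[ℂ] MinTensor A B := toMin.toLinearMap
  let L' : AlgTensor A B →L[ℂ] E :=
    LinearMap.mkContinuous (L ∘ₗ (toAlg (A := A) (B := B)).symm.toLinearMap) C (fun x => h _)
  let e' : AlgTensor A B →L[ℂ] MinTensor A B :=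
    LinearMap.mkContinuous (e ∘ₗ (toAlg (A := A) (B := B)).symm.toLinearMap) 1 (fun x => by
      rw [one_mul]; exact (norm_toMin _).le)
  refine ⟨L'.extend e', fun x => ?_⟩
  refine ContinuousLinearMap.extend_eq (e := e') L' denseRange_toMin ?_ (toAlg x)
  exact UniformSpace.Completion.isUniformInducing_coe (AlgTensor A B)

end Extension

/-! ### Product functionals and slice maps -/

namespace PosFun

variable {A B : Type u} [CStarAlgebra A] [CStarAlgebra B]

theorem inner_tensorRep_tmul (π : HilbertRep A) (ρ : HilbertRep B) (ξ ξ' : π.H) (η η' : ρ.H)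
    (a : A) (b : B) :
    inner ℂ (toHilbert (ξ ⊗ₜ[ℂ] η)) (tensorRep π ρ (a ⊗ₜ b) (toHilbert (ξ' ⊗ₜ[ℂ] η'))) =
      inner ℂ ξ (π.π a ξ') * inner ℂ η (ρ.π b η') := by
  rw [tensorRep_tmul, opTensor_toHilbert, inner_toHilbert, TensorProduct.mapL_tmul,
    TensorProduct.inner_tmul]

theorem norm_inner_tensorRep_le (π : HilbertRep A) (ρ : HilbertRep B) (ξ ξ' : π.H) (η η' : ρ.H)
    (x : A ⊗[ℂ] B) :
    ‖inner ℂ (toHilbert (ξ ⊗ₜ[ℂ] η)) (tensorRep π ρ x (toHilbert (ξ' ⊗ₜ[ℂ] η')))‖ ≤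
      ‖ξ‖ * ‖η‖ * (minNorm x * (‖ξ'‖ * ‖η'‖)) := by
  refine (norm_inner_le_norm _ _).trans ?_
  rw [LinearIsometry.norm_map, TensorProduct.norm_tmul]
  gcongr
  refine (ContinuousLinearMap.le_opNorm _ _).trans ?_
  rw [LinearIsometry.norm_map, TensorProduct.norm_tmul]
  gcongr
  exact le_minNorm π ρ x

/-- The functional is the vector functional of ξ ⊗ ζ in the tensor product of the two GNS
representations. It is bounded by the minimal norm, and positivity passes from the algebraic tensor
product to its completion. -/
theorem exists_tensor (f : PosFun A) (g : PosFun B) :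
    ∃ T : PosFun (MinTensor A B), ∀ a b, T (toMin (a ⊗ₜ b)) = f a * g b := by
  obtain ⟨π, ξ, hf⟩ := f.exists_gns
  obtain ⟨ρ, ζ, hg⟩ := g.exists_gns
  let v := toHilbert (ξ ⊗ₜ[ℂ] ζ)
  let L : A ⊗[ℂ] B →ₗ[ℂ] ℂ :=
    { toFun := fun x => inner ℂ v (tensorRep π ρ x v)
      map_add' := fun x y => by rw [map_add, _root_.add_apply, inner_add_right]
      map_smul' := fun c x => by
        rw [map_smul, smul_apply, inner_smul_right]; rfl }
  obtain ⟨T, hT⟩ := exists_extension L (‖ξ‖ * ‖ζ‖ * (‖ξ‖ * ‖ζ‖)) fun x =>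
    (norm_inner_tensorRep_le π ρ ξ ξ ζ ζ x).trans_eq (by ring)
  refine ⟨⟨T, fun x => ?_⟩, fun a b => ?_⟩
  · refine denseRange_toMin.induction_on (p := fun x => 0 ≤ T (star x * x)) x
      (isClosed_le continuous_const
        (T.continuous.comp (continuous_star_min.mul continuous_id))) fun y => ?_
    rw [star_toMin, ← map_mul, hT]
    change 0 ≤ inner ℂ v (tensorRep π ρ (star y * y) v)
    rw [map_mul, tensorRep_star, ContinuousLinearMap.star_eq_adjoint,
      mul_apply_eq_comp, ContinuousLinearMap.adjoint_inner_right]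
    exact RCLike.nonneg_iff.2 ⟨inner_self_nonneg, inner_self_im _⟩
  · rw [coe_mk, hT, hf, hg]
    exact inner_tensorRep_tmul π ρ ξ ξ ζ ζ a b

/-- The product functional `f ⊗ g` on the minimal tensor product. -/
def tensor (f : PosFun A) (g : PosFun B) : PosFun (MinTensor A B) := (exists_tensor f g).choose

@[simp] theorem tensor_tmul (f : PosFun A) (g : PosFun B) (a : A) (b : B) :
    f.tensor g (toMin (a ⊗ₜ b)) = f a * g b := (exists_tensor f g).choose_spec a b

/-- In any representation ρ of `B`, the matrix coefficients of (f ⊗ id)(x) are coefficients of (π ⊗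
ρ)(x) between ξ ⊗ θ and ξ ⊗ η. So the slice is bounded by ‖ξ‖² times the minimal norm in every
representation, hence in norm by `norm_le_of_rep`. -/
theorem exists_sliceLeft (f : PosFun A) :
    ∃ S : MinTensor A B →L[ℂ] B, ∀ a b, S (toMin (a ⊗ₜ b)) = f a • b := by
  obtain ⟨π, ξ, hf⟩ := f.exists_gns
  let L : A ⊗[ℂ] B →ₗ[ℂ] B := TensorProduct.lift (LinearMap.lsmul ℂ B ∘ₗ (f.toCLM : A →ₗ[ℂ] ℂ))
  have hL : ∀ a b, L (a ⊗ₜ b) = f a • b := fun a b => rfl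
  obtain ⟨S, hS⟩ := exists_extension L (‖ξ‖ * ‖ξ‖) fun x => by
    refine norm_le_of_rep (by have := minNorm_nonneg x; positivity) fun ρ η => ?_
    have h : ∀ θ, inner ℂ θ (ρ.π (L x) η) =
        inner ℂ (toHilbert (ξ ⊗ₜ[ℂ] θ)) (tensorRep π ρ x (toHilbert (ξ ⊗ₜ[ℂ] η))) := fun θ => by
      induction x using TensorProduct.induction_on with
      | zero => simp
      | add x y hx hy => simp only [map_add, _root_.add_apply, inner_add_right, hx, hy]
      | tmul a b =>
        rw [inner_tensorRep_tmul, hL, map_smul, smul_apply, inner_smul_right,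
          hf]
    -- The choice θ = ρ(Lx)η makes the left side ‖ρ(Lx)η‖²; one factor is then cancelled.
    have h1 := norm_inner_tensorRep_le π ρ ξ ξ (ρ.π (L x) η) η x
    rw [← h, inner_self_eq_norm_sq_to_K] at h1
    rw [norm_pow, RCLike.norm_ofReal, abs_norm, sq] at h1
    rcases (norm_nonneg (ρ.π (L x) η)).eq_or_lt with h0 | h0
    · rw [← h0]; have := minNorm_nonneg x; positivity
    · exact le_of_mul_le_mul_left (h1.trans_eq (by ring)) h0
  exact ⟨S, fun a b => by rw [hS, hL]⟩

theorem exists_sliceRight (g : PosFun B) :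
    ∃ S : MinTensor A B →L[ℂ] A, ∀ a b, S (toMin (a ⊗ₜ b)) = g b • a := by
  obtain ⟨ρ, ξ, hg⟩ := g.exists_gns
  let L : A ⊗[ℂ] B →ₗ[ℂ] A :=
    TensorProduct.lift (LinearMap.lsmul ℂ A ∘ₗ (g.toCLM : B →ₗ[ℂ] ℂ)).flip
  have hL : ∀ a b, L (a ⊗ₜ b) = g b • a := fun a b => rfl
  obtain ⟨S, hS⟩ := exists_extension L (‖ξ‖ * ‖ξ‖) fun x => by
    refine norm_le_of_rep (by have := minNorm_nonneg x; positivity) fun π η => ?_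
    have h : ∀ θ, inner ℂ θ (π.π (L x) η) =
        inner ℂ (toHilbert (θ ⊗ₜ[ℂ] ξ)) (tensorRep π ρ x (toHilbert (η ⊗ₜ[ℂ] ξ))) := fun θ => by
      induction x using TensorProduct.induction_on with
      | zero => simp
      | add x y hx hy => simp only [map_add, _root_.add_apply, inner_add_right, hx, hy]
      | tmul a b =>
        rw [inner_tensorRep_tmul, hL, map_smul, smul_apply, inner_smul_right,
          hg, mul_comm]
    have h1 := norm_inner_tensorRep_le π ρ (π.π (L x) η) η ξ ξ x
    rw [← h, inner_self_eq_norm_sq_to_K] at h1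
    rw [norm_pow, RCLike.norm_ofReal, abs_norm, sq] at h1
    rcases (norm_nonneg (π.π (L x) η)).eq_or_lt with h0 | h0
    · rw [← h0]; have := minNorm_nonneg x; positivity
    · exact le_of_mul_le_mul_left (h1.trans_eq (by ring)) h0
  exact ⟨S, fun a b => by rw [hS, hL]⟩

/-- The slice map `f ⊗ id`. -/
def sliceLeft (f : PosFun A) : MinTensor A B →L[ℂ] B := f.exists_sliceLeft.choose

@[simp] theorem sliceLeft_tmul (f : PosFun A) (a : A) (b : B) :
    f.sliceLeft (toMin (a ⊗ₜ b)) = f a • b := f.exists_sliceLeft.choose_spec a b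

/-- The slice map `id ⊗ g`. -/
def sliceRight (g : PosFun B) : MinTensor A B →L[ℂ] A := g.exists_sliceRight.choose

@[simp] theorem sliceRight_tmul (g : PosFun B) (a : A) (b : B) :
    g.sliceRight (toMin (a ⊗ₜ b)) = g b • a := g.exists_sliceRight.choose_spec a b

theorem tensor_eq_sliceLeft (f : PosFun A) (g : PosFun B) (x : MinTensor A B) :
    f.tensor g x = g (f.sliceLeft x) :=
  DFunLike.congr_fun (continuous_linear_ext (S := (f.tensor g).toCLM)
    (T := g.toCLM.comp f.sliceLeft) fun a b => by simp) x

theorem tensor_eq_sliceRight (f : PosFun A) (g : PosFun B) (x : MinTensor A B) :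
    f.tensor g x = f (g.sliceRight x) :=
  DFunLike.congr_fun (continuous_linear_ext (S := (f.tensor g).toCLM)
    (T := f.toCLM.comp g.sliceRight) fun a b => by simp [mul_comm]) x

theorem tensor_add_left (f f' : PosFun A) (g : PosFun B) :
    (f + f').tensor g = f.tensor g + f'.tensor g := by
  ext x
  exact DFunLike.congr_fun (continuous_linear_ext (S := ((f + f').tensor g).toCLM)
    (T := (f.tensor g + f'.tensor g).toCLM) fun a b => by simp [add_apply, add_mul]) x

/-- Elements (1 ⊗ c)Δ(a) span the dense subspace in `dense_right`; this computes their slices. -/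
theorem sliceLeft_mul (f : PosFun A) (c : B) (x : MinTensor A B) :
    f.sliceLeft (toMin (1 ⊗ₜ c) * x) = c * f.sliceLeft x :=
  DFunLike.congr_fun (continuous_linear_ext
    (S := f.sliceLeft.comp (ContinuousLinearMap.mul ℂ (MinTensor A B) (toMin (1 ⊗ₜ[ℂ] c))))
    (T := (ContinuousLinearMap.mul ℂ B c).comp f.sliceLeft) fun a b => by
      simp [← map_mul]) x

theorem sliceLeft_smul {f f' : PosFun A} {t : ℂ} (h : ∀ a, f a = t * f' a) (x : MinTensor A B) :
    f.sliceLeft x = t • f'.sliceLeft x :=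
  DFunLike.congr_fun (continuous_linear_ext (S := f.sliceLeft)
    (T := t • f'.sliceLeft) fun a b => by simp [h, mul_smul]) x

end PosFun

/-! ### The state space and invariant means -/

section States

variable {Q : Type u} [CStarAlgebra Q]

/-- The state space of a C⋆-algebra. -/
def stateSpace (Q : Type u) [CStarAlgebra Q] : Set (WeakDual ℂ Q) :=
  {h | (∀ a, 0 ≤ h (star a * a)) ∧ h 1 = 1}

theorem isCompact_stateSpace : IsCompact (stateSpace Q) := by
  refine (WeakDual.isCompact_closedBall (𝕜 := ℂ) (E := Q) 0 1).of_isClosed_subset ?_ ?_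
  · refine IsClosed.inter ?_ (isClosed_eq (WeakDual.eval_continuous 1) continuous_const)
    have h : IsClosed (⋂ a : Q, {h : WeakDual ℂ Q | 0 ≤ h (star a * a)}) :=
      isClosed_iInter fun a => isClosed_le continuous_const (WeakDual.eval_continuous _)
    have e : {h : WeakDual ℂ Q | ∀ a, 0 ≤ h (star a * a)} = ⋂ a : Q, {h | 0 ≤ h (star a * a)} := by
      ext
      simp
    rw [← e] at h
    exact h
  · rintro h ⟨h0, h1⟩
    let f : PosFun Q := ⟨WeakDual.toStrongDual h, h0⟩
    have hf : ‖f 1‖ = 1 := by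
      change ‖h 1‖ = 1
      rw [h1, norm_one]
    rw [Set.mem_preimage, mem_closedBall_zero_iff]
    refine ContinuousLinearMap.opNorm_le_bound _ zero_le_one fun a => ?_
    rw [← hf]
    exact f.norm_apply_le a

/-- An element of the state space, as a positive functional. -/
def PosFun.ofState {h : WeakDual ℂ Q} (hh : h ∈ stateSpace Q) : PosFun Q :=
  ⟨WeakDual.toStrongDual h, hh.1⟩

/-- A limit of Cesàro means of a sequence of states. -/
theorem exists_mean (s : ℕ → PosFun Q) (hs : ∀ n, s n 1 = 1) :
    ∃ h : PosFun Q, h 1 = 1 ∧ ∀ x y, (∀ k, s k x = s (k + 1) y) → h x = h y := by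
  let μ : ℕ → Q →L[ℂ] ℂ := fun n => ((n + 1 : ℕ) : ℂ)⁻¹ • ∑ k ∈ Finset.range (n + 1), (s k).toCLM
  have hμ : ∀ n a, μ n a = ((n + 1 : ℕ) : ℂ)⁻¹ * ∑ k ∈ Finset.range (n + 1), s k a := fun n a => by
    simp [μ]
  let ν : ℕ → WeakDual ℂ Q := fun n => StrongDual.toWeakDual (μ n)
  have hν : ∀ n, ν n ∈ stateSpace Q := fun n => by
    constructor
    · intro a
      change 0 ≤ μ n (star a * a)
      rw [hμ]
      refine mul_nonneg ?_ (Finset.sum_nonneg fun k _ => (s k).nonneg a)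
      rw [← Complex.ofReal_natCast, ← Complex.ofReal_inv]
      exact_mod_cast (by positivity)
    · change μ n 1 = 1
      rw [hμ]
      simp only [hs, Finset.sum_const, Finset.card_range, nsmul_eq_mul, mul_one]
      exact inv_mul_cancel₀ (Nat.cast_ne_zero.2 n.succ_ne_zero)
  -- The state space is compact but possibly not sequentially compact, so the limit is taken along a
  -- free ultrafilter on ℕ.
  obtain ⟨h, hh, hlim⟩ := (isCompact_stateSpace (Q := Q)).ultrafilter_le_nhds
    ((hyperfilter ℕ).map ν) (by
      rw [Ultrafilter.coe_map, le_principal_iff, mem_map]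
      exact univ_mem' hν)
  have hlim' : ∀ a, Tendsto (fun n => μ n a) (hyperfilter ℕ) (𝓝 (h a)) := fun a =>
    ((WeakDual.eval_continuous a).tendsto h).comp hlim
  refine ⟨PosFun.ofState hh, hh.2, fun x y hxy => ?_⟩
  have h1 : Tendsto (fun n => μ n x - μ n y) (hyperfilter ℕ) (𝓝 (h x - h y)) :=
    (hlim' x).sub (hlim' y)
  have h2 : ∀ n, ‖μ n x - μ n y‖ ≤ 2 * ‖y‖ * (1 / ((n : ℝ) + 1)) := fun n => by
    rw [hμ, hμ, ← mul_sub, ← Finset.sum_sub_distrib]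
    simp only [hxy]
    -- The difference of the two means telescopes to (s (n+1) y − s 0 y)/(n+1), which tends to zero.
    rw [Finset.sum_range_sub (fun k => s k y)]
    have h3 : ∀ k, ‖s k y‖ ≤ ‖y‖ := fun k => by
      have := (s k).norm_apply_le y
      rwa [hs, norm_one, one_mul] at this
    rw [norm_mul, norm_inv, Complex.norm_natCast, mul_comm, one_div, Nat.cast_add_one]
    gcongr
    exact (norm_sub_le _ _).trans ((add_le_add (h3 _) (h3 _)).trans_eq (by ring))
  have h3 : Tendsto (fun n : ℕ => 2 * ‖y‖ * (1 / ((n : ℝ) + 1))) (hyperfilter ℕ) (𝓝 0) := by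
    have := (tendsto_one_div_add_atTop_nhds_zero_nat (𝕜 := ℝ)).const_mul (2 * ‖y‖)
    rw [mul_zero] at this
    exact this.mono_left Nat.hyperfilter_le_atTop
  exact sub_eq_zero.1 (tendsto_nhds_unique h1 (squeeze_zero_norm h2 h3))

theorem PosFun.exists_normalization {f : PosFun Q} (hf : f 1 ≠ 0) :
    ∃ g : PosFun Q, g 1 = 1 ∧ ∀ a, f a = f 1 * g a := by
  have h0 : 0 ≤ f 1 := by simpa using f.nonneg 1
  obtain ⟨hre, him⟩ := Complex.nonneg_iff.1 h0
  have hr : f 1 = ((f 1).re : ℂ) := Complex.ext rfl (by simpa using him.symm)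
  have hi : 0 ≤ (f 1)⁻¹ := by
    rw [hr, ← Complex.ofReal_inv]
    exact_mod_cast inv_nonneg.2 hre
  exact ⟨⟨(f 1)⁻¹ • f.toCLM, fun a => mul_nonneg hi (f.nonneg a)⟩, inv_mul_cancel₀ hf,
    fun a => (mul_inv_cancel_left₀ hf (f a)).symm⟩

theorem PosFun.exists_map_one_ne_zero [Nontrivial Q] : ∃ f : PosFun Q, f 1 ≠ 0 := by
  by_contra! h
  exact one_ne_zero (PosFun.separating h)

/-- The sum of the family dominates each member; starting the sum with a functional nonzero at 1
keeps it normalisable even for the empty family. This reduces invariance under finitely many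
functionals to invariance under one. -/
theorem PosFun.exists_forall_le [Nontrivial Q] (s : Finset (PosFun Q)) :
    ∃ ω : PosFun Q, ω 1 ≠ 0 ∧ ∀ ρ ∈ s, ∃ ρ', ρ + ρ' = ω := by
  classical
  induction s using Finset.induction_on with
  | empty =>
    obtain ⟨f, hf⟩ := PosFun.exists_map_one_ne_zero (Q := Q)
    exact ⟨f, hf, by simp⟩
  | insert σ s _ ih =>
    obtain ⟨ω, hω, h⟩ := ih
    refine ⟨σ + ω, fun h0 => hω ?_, fun ρ hρ => ?_⟩
    · have h1 : ∀ f : PosFun Q, 0 ≤ f 1 := fun f => by simpa using f.nonneg 1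
      rw [PosFun.add_apply] at h0
      exact ((add_eq_zero_iff_of_nonneg (h1 _) (h1 _)).1 h0).2
    · rcases Finset.mem_insert.1 hρ with rfl | hρ
      · exact ⟨ω, rfl⟩
      · obtain ⟨ρ', rfl⟩ := h ρ hρ
        refine ⟨σ + ρ', ?_⟩
        ext a
        simp only [PosFun.add_apply]
        ring

end States

/-! ### Convolution and the Haar state -/

namespace CompactQuantumGroup

variable {Q : Type u} [CStarAlgebra Q] (G : CompactQuantumGroup Q)

/-- The comultiplication as a continuous linear map. -/
def comulL : Q →L[ℂ] MinTensor Q Q :=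
  ⟨(G.Δ : Q →ₗ[ℂ] MinTensor Q Q), AddMonoidHomClass.continuous_of_bound G.Δ 1 fun a => by
    rw [one_mul]; exact NonUnitalStarAlgHom.norm_apply_le G.Δ a⟩

/-- The map `(f ⊗ id) ∘ Δ`. -/
def act (f : PosFun Q) : Q →L[ℂ] Q := f.sliceLeft.comp G.comulL

theorem act_apply (f : PosFun Q) (a : Q) : G.act f a = f.sliceLeft (G.Δ a) := rfl

/-- The convolution `(f ⊗ g) ∘ Δ` of positive functionals. -/
def conv (f g : PosFun Q) : PosFun Q :=
  ⟨(f.tensor g).toCLM.comp G.comulL, fun a => by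
    have := (f.tensor g).nonneg (G.Δ a)
    rwa [← StarHomClass.map_star, ← map_mul] at this⟩

theorem conv_apply (f g : PosFun Q) (a : Q) : G.conv f g a = f.tensor g (G.Δ a) := rfl

theorem conv_apply_act (f g : PosFun Q) (a : Q) : G.conv f g a = g (G.act f a) := by
  rw [conv_apply, PosFun.tensor_eq_sliceLeft, act_apply]

theorem conv_one (f g : PosFun Q) : G.conv f g 1 = f 1 * g 1 := by
  rw [conv_apply, map_one, ← map_one (toMin (A := Q) (B := Q)), Algebra.TensorProduct.one_def,
    PosFun.tensor_tmul]

theorem minMap_continuous {A B C D : Type u} [CStarAlgebra A] [CStarAlgebra B] [CStarAlgebra C]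
    [CStarAlgebra D] (f : A →⋆ₐ[ℂ] C) (g : B →⋆ₐ[ℂ] D) : Continuous (minMap f g) :=
  continuous_minMapRingHom f g

/-- `minMap f g` as a continuous linear map. -/
def minMapL {A B C D : Type u} [CStarAlgebra A] [CStarAlgebra B] [CStarAlgebra C]
    [CStarAlgebra D] (f : A →⋆ₐ[ℂ] C) (g : B →⋆ₐ[ℂ] D) : MinTensor A B →L[ℂ] MinTensor C D :=
  ⟨(minMap f g : MinTensor A B →ₗ[ℂ] MinTensor C D), minMap_continuous f g⟩

theorem sliceLeft_minMap_left (f g : PosFun Q) (x : MinTensor Q Q) :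
    (f.tensor g).sliceLeft (minMap G.Δ (StarAlgHom.id ℂ Q) x) = (G.conv f g).sliceLeft x :=
  DFunLike.congr_fun (continuous_linear_ext
    (S := (f.tensor g).sliceLeft.comp (minMapL G.Δ (StarAlgHom.id ℂ Q)))
    (T := (G.conv f g).sliceLeft) fun a b => by
      change (f.tensor g).sliceLeft (minMap G.Δ (StarAlgHom.id ℂ Q) (toMin (a ⊗ₜ[ℂ] b))) = _
      rw [minMap_toMin, Algebra.TensorProduct.map_tmul, PosFun.sliceLeft_tmul]
      exact ((G.conv f g).sliceLeft_tmul a b).symm) x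

theorem sliceLeft_minMap_right (f : PosFun Q) (x : MinTensor Q Q) :
    f.sliceLeft (minMap (StarAlgHom.id ℂ Q) G.Δ x) = G.Δ (f.sliceLeft x) :=
  DFunLike.congr_fun (continuous_linear_ext
    (S := f.sliceLeft.comp (minMapL (StarAlgHom.id ℂ Q) G.Δ))
    (T := G.comulL.comp f.sliceLeft) fun a b => by
      change f.sliceLeft (minMap (StarAlgHom.id ℂ Q) G.Δ (toMin (a ⊗ₜ[ℂ] b))) = G.Δ _
      rw [minMap_toMin, Algebra.TensorProduct.map_tmul, PosFun.sliceLeft_tmul]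
      exact ((congrArg G.Δ (f.sliceLeft_tmul a b)).trans (map_smul G.Δ _ _)).symm) x

/-- Both sides depend continuously on (z, w), so the equality is a closed condition, and associated
pairs are limits of images of algebraic tensors, where it is a direct computation. -/
theorem sliceLeft_assoc (f g : PosFun Q) {z : MinTensor (MinTensor Q Q) Q}
    {w : MinTensor Q (MinTensor Q Q)} (h : IsAssociated z w) :
    (f.tensor g).sliceLeft z = g.sliceLeft (f.sliceLeft w) := by
  let S : Set (MinTensor (MinTensor Q Q) Q × MinTensor Q (MinTensor Q Q)) :=
    {p | (f.tensor g).sliceLeft p.1 = g.sliceLeft (f.sliceLeft p.2)}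
  have hS : IsClosed S := isClosed_eq (by fun_prop) (by fun_prop)
  refine (closure_minimal ?_ hS h : (z, w) ∈ S)
  rintro _ ⟨x, rfl⟩
  change (f.tensor g).sliceLeft _ = g.sliceLeft (f.sliceLeft _)
  induction x using TensorProduct.induction_on with
  | zero => simp only [map_zero]
  | add x y hx hy => simp only [map_add, hx, hy]
  | tmul x c =>
    induction x using TensorProduct.induction_on with
    | zero => simp only [TensorProduct.zero_tmul, map_zero]
    | add x y hx hy => simp only [TensorProduct.add_tmul, map_add, hx, hy]
    | tmul a b => simp [mul_smul]

/-- Coassociativity in usable form: slicing turns convolution into composition, in reversed order.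
-/
theorem act_act (f g : PosFun Q) (a : Q) : G.act g (G.act f a) = G.act (G.conv f g) a := by
  rw [act_apply, act_apply, act_apply, ← sliceLeft_minMap_right, ← sliceLeft_minMap_left]
  exact (sliceLeft_assoc f g (G.coassoc a)).symm

theorem conv_assoc (f g k : PosFun Q) : G.conv (G.conv f g) k = G.conv f (G.conv g k) := by
  ext a
  rw [conv_apply_act, ← act_act, conv_apply_act _ f, conv_apply_act]

/-- For every state `ω` there is a state invariant under convolution by `ω` on both sides. -/
theorem exists_invariant_state (ω : PosFun Q) (hω : ω 1 = 1) :
    ∃ h : PosFun Q, h 1 = 1 ∧ G.conv h ω = h ∧ G.conv ω h = h := by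
  -- `p n` is the (n+1)-st convolution power of ω; starting at ω avoids needing a counit as zeroth
  -- power.
  let p : ℕ → PosFun Q := fun n => n.rec ω fun _ f => G.conv ω f
  have hp : ∀ n, p (n + 1) = G.conv ω (p n) := fun n => rfl
  have hp' : ∀ n, p (n + 1) = G.conv (p n) ω := fun n => by
    induction n with
    | zero => rfl
    | succ n ih =>
      rw [hp (n + 1)]
      conv_lhs => rw [ih, ← conv_assoc, ← hp]
  have hp1 : ∀ n, p n 1 = 1 := fun n => by
    induction n with
    | zero => exact hω
    | succ n ih => rw [hp, conv_one, hω, ih, one_mul]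
  -- Convolution with ω on either side shifts the sequence by one, which the mean does not see.
  obtain ⟨h, h1, hh⟩ := exists_mean p hp1
  refine ⟨h, h1, ?_, ?_⟩
  · ext a
    rw [conv_apply, PosFun.tensor_eq_sliceRight]
    refine hh _ _ fun k => ?_
    rw [hp', conv_apply, PosFun.tensor_eq_sliceRight]
  · ext a
    rw [conv_apply_act]
    refine hh _ _ fun k => ?_
    rw [hp, conv_apply_act]

/-- Write ω = ρ + ρ', b = (h ⊗ id)Δ(a) and d = Δ(b) − 1 ⊗ b. Invariance of h under ω gives (ω ⊗
h)(d*d) = 0, hence (ρ ⊗ h)(d*d) = 0 by domination, hence (ρ ⊗ h)((1 ⊗ c)d) = 0 for every c. Since b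
is itself a slice, this says that (h * ρ) ⊗ h and ρ(1) h ⊗ h agree on (1 ⊗ c)Δ(a). Such elements
have dense span, so the two functionals coincide. -/
theorem conv_eq_of_le {h ρ ρ' : PosFun Q} (h1 : h 1 = 1) {t : ℂ} (ht : (ρ + ρ') 1 = t)
    (hr : ∀ a, G.conv h (ρ + ρ') a = t * h a) (hl : ∀ a, G.conv (ρ + ρ') h a = t * h a) (x : Q) :
    G.conv h ρ x = ρ 1 * h x := by
  let ω := ρ + ρ'
  have key : ∀ a c, h (c * G.act (G.conv h ρ) a) = ρ 1 * h (c * G.act h a) := fun a c => by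
    let b := G.act h a
    let d := G.Δ b - toMin (1 ⊗ₜ b)
    have hb : G.act ω b = t • b := by
      rw [act_act]
      exact PosFun.sliceLeft_smul hr _
    have e : ∀ f : PosFun Q, f.tensor h (toMin (1 ⊗ₜ star b) * G.Δ b) = h (star b * G.act f b) :=
      fun f => by rw [PosFun.tensor_eq_sliceLeft, PosFun.sliceLeft_mul]; rfl
    have e1 : ω.tensor h (toMin (1 ⊗ₜ star b) * G.Δ b) = t * h (star b * b) := by
      rw [e, hb, mul_smul_comm, map_smul, smul_eq_mul]
    have hst : star (toMin ((1 : Q) ⊗ₜ[ℂ] b)) = toMin (1 ⊗ₜ star b) := by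
      rw [star_toMin, TensorProduct.star_tmul, star_one]
    have ht' : star t = t := by
      rw [← ht, ← PosFun.map_star, star_one]
    have e2 : ω.tensor h (star (G.Δ b) * toMin (1 ⊗ₜ b)) = t * h (star b * b) := by
      rw [← star_star (star (G.Δ b) * toMin (1 ⊗ₜ b)), star_mul, star_star, PosFun.map_star, hst,
        e1, star_mul', ht', ← PosFun.map_star, star_mul, star_star]
    have e3 : ω.tensor h (star (G.Δ b) * G.Δ b) = t * h (star b * b) := by
      rw [← StarHomClass.map_star, ← map_mul, ← conv_apply, hl]
    have e4 : ω.tensor h (toMin (1 ⊗ₜ star b) * toMin (1 ⊗ₜ b)) = t * h (star b * b) := by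
      rw [← map_mul, Algebra.TensorProduct.tmul_mul_tmul, PosFun.tensor_tmul, one_mul, ht]
    -- Each of the four terms of d*d has value ± t h(b*b): the mixed ones by `hb` and conjugation,
    -- the pure ones by ω * h = t h and by ω(1) = t.
    have hd : ω.tensor h (star d * d) = 0 := by
      simp only [d, star_sub, sub_mul, mul_sub, map_sub, hst, e1, e2, e3, e4]
      ring
    have hd' : ρ.tensor h (star d * d) = 0 := by
      rw [PosFun.tensor_add_left, PosFun.add_apply] at hd
      exact ((add_eq_zero_iff_of_nonneg (PosFun.nonneg _ _) (PosFun.nonneg _ _)).1 hd).1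
    have h2 := PosFun.map_mul_eq_zero _ hd' (toMin (1 ⊗ₜ c))
    rw [mul_sub, map_sub, sub_eq_zero, PosFun.tensor_eq_sliceLeft, PosFun.sliceLeft_mul,
      ← map_mul, Algebra.TensorProduct.tmul_mul_tmul, PosFun.tensor_tmul, mul_one] at h2
    rw [← act_act]
    exact h2
  have h2 : ∀ z, (G.conv h ρ).tensor h z = ρ 1 * h.tensor h z := fun z => by
    refine G.dense_right.induction (P := fun z => (G.conv h ρ).tensor h z = ρ 1 * h.tensor h z)
      (fun z hz => ?_) (isClosed_eq (map_continuous _)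
        (continuous_const.mul (map_continuous _))) z
    induction hz using Submodule.span_induction with
    | mem z hz =>
      obtain ⟨c, a, rfl⟩ := hz
      rw [PosFun.tensor_eq_sliceLeft, PosFun.sliceLeft_mul, PosFun.tensor_eq_sliceLeft,
        PosFun.sliceLeft_mul]
      exact key a c
    | zero => simp
    | add x y _ _ hx hy => rw [map_add, map_add, hx, hy, mul_add]
    | smul c x _ hx => rw [map_smul, map_smul, hx, smul_eq_mul, smul_eq_mul, mul_left_comm]
  -- Since h(1) = 1, evaluating at x ⊗ 1 removes the second leg.
  simpa [h1] using h2 (toMin (x ⊗ₜ 1))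

/-- Existence of the Haar state. -/
theorem exists_haar [Nontrivial Q] :
    ∃ h : PosFun Q, h 1 = 1 ∧ ∀ a, h.sliceLeft (G.Δ a) = h a • (1 : Q) := by
  let K : PosFun Q → Set (WeakDual ℂ Q) := fun ρ =>
    ⋂ a : Q, {h | h (ρ.sliceRight (G.Δ a)) = ρ 1 * h a}
  have hK : ∀ ρ, IsClosed (K ρ) := fun ρ => isClosed_iInter fun a =>
    isClosed_eq (WeakDual.eval_continuous _) (continuous_const.mul (WeakDual.eval_continuous _))
  -- Finite intersection property: for a finite set of functionals, a state invariant under a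
  -- normalised dominating ω lies in all the corresponding `K ρ`.
  obtain ⟨h, hh, hmem⟩ := (isCompact_stateSpace (Q := Q)).inter_iInter_nonempty K hK fun s => by
    obtain ⟨ω, hω, hs⟩ := PosFun.exists_forall_le s
    obtain ⟨ω', hω', hωω'⟩ := PosFun.exists_normalization hω
    obtain ⟨h, h1, hr, hl⟩ := G.exists_invariant_state ω' hω'
    refine ⟨StrongDual.toWeakDual h.toCLM, ⟨h.nonneg, h1⟩,
      Set.mem_iInter₂.2 fun ρ hρ => Set.mem_iInter.2 fun a => ?_⟩
    obtain ⟨ρ', rfl⟩ := hs ρ hρ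
    change h (ρ.sliceRight (G.Δ a)) = ρ 1 * h a
    rw [← PosFun.tensor_eq_sliceRight, ← conv_apply]
    refine G.conv_eq_of_le (ρ' := ρ') h1 rfl (fun a => ?_) (fun a => ?_) a
    · rw [conv_apply_act, hωω', ← conv_apply_act, hr]
    · rw [conv_apply_act, act_apply, PosFun.sliceLeft_smul hωω', map_smul, ← act_apply,
        ← conv_apply_act, hl, smul_eq_mul]
  -- Membership in every `K ρ` says that all positive ρ take the same value at (h ⊗ id)Δ(a) and
  -- h(a)1; positive functionals separate points.
  refine ⟨PosFun.ofState hh, hh.2, fun a => sub_eq_zero.1 (PosFun.separating fun ρ => ?_)⟩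
  have h1 : (PosFun.ofState hh) (ρ.sliceRight (G.Δ a)) = ρ 1 * (PosFun.ofState hh) a :=
    Set.mem_iInter.1 (Set.mem_iInter.1 hmem ρ) a
  rw [map_sub, ← PosFun.tensor_eq_sliceLeft, PosFun.tensor_eq_sliceRight, h1, map_smul,
    smul_eq_mul, mul_comm, sub_self]

end CompactQuantumGroup

/-! ### Intertwiners and direct summands -/

variable {Q : Type u} [CStarAlgebra Q] {G : CompactQuantumGroup Q}

namespace Intertwines

variable {ι κ : Type} [Fintype ι] [Fintype κ]

theorem add {T S : Matrix κ ι ℂ} {u : Matrix ι ι Q} {v : Matrix κ κ Q} (hT : Intertwines T u v)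
    (hS : Intertwines S u v) : Intertwines (T + S) u v := by
  unfold Intertwines at *
  rw [Matrix.map_add _ (map_add _), Matrix.add_mul, Matrix.mul_add, hT, hS]

theorem smul {T : Matrix κ ι ℂ} {u : Matrix ι ι Q} {v : Matrix κ κ Q} (hT : Intertwines T u v)
    (c : ℂ) : Intertwines (c • T) u v := by
  rw [intertwines_iff] at *
  intro a j
  simpa [Finset.smul_sum, mul_smul] using congrArg (c • ·) (hT a j)

theorem zero (u : Matrix ι ι Q) (v : Matrix κ κ Q) : Intertwines 0 u v := by
  simp [intertwines_iff]

/-- Unitarity turns Tu = vT into v*T = Tu*; the adjoint of this is the claim. It makes endomorphism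
spaces self-adjoint, which gives complete reducibility. -/
theorem conjTranspose [DecidableEq ι] [DecidableEq κ] {T : Matrix κ ι ℂ} {u : Matrix ι ι Q}
    {v : Matrix κ κ Q} (hu : u ∈ unitary (Matrix ι ι Q)) (hv : v ∈ unitary (Matrix κ κ Q))
    (hT : Intertwines T u v) : Intertwines T.conjTranspose v u := by
  unfold Intertwines at *
  have h1 : star v * T.map (algebraMap ℂ Q) = T.map (algebraMap ℂ Q) * star u := by
    calc star v * T.map (algebraMap ℂ Q)
        = star v * (T.map (algebraMap ℂ Q) * u) * star u := by
          rw [Matrix.mul_assoc, Matrix.mul_assoc (T.map _), (Unitary.mem_iff.1 hu).2,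
            Matrix.mul_one]
      _ = star v * v * T.map (algebraMap ℂ Q) * star u := by
          rw [hT, Matrix.mul_assoc (star v) v]
      _ = _ := by rw [(Unitary.mem_iff.1 hv).1, Matrix.one_mul]
  have h2 := congrArg Matrix.conjTranspose h1
  rw [Matrix.conjTranspose_mul, Matrix.conjTranspose_mul, Matrix.star_eq_conjTranspose,
    Matrix.star_eq_conjTranspose, Matrix.conjTranspose_conjTranspose,
    Matrix.conjTranspose_conjTranspose, ← Matrix.conjTranspose_map _ (fun x => by
      exact (algebraMap_star_comm x))] at h2
  exact h2

end Intertwines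

namespace IsSummand

variable {ι κ μ : Type} [Fintype ι] [Fintype κ] [DecidableEq κ] [Fintype μ] [DecidableEq μ]

theorem trans {u : Matrix μ μ Q} {v : Matrix κ κ Q} {w : Matrix ι ι Q}
    (h : IsSummand u v) (h' : IsSummand v w) : IsSummand u w := by
  obtain ⟨T, S, hT, hS, h1⟩ := h
  obtain ⟨T', S', hT', hS', h1'⟩ := h'
  refine ⟨T' * T, S * S', hT'.comp hT, hS.comp hS', ?_⟩
  rw [Matrix.mul_assoc, ← Matrix.mul_assoc S', h1', Matrix.one_mul, h1]

theorem of_equivalent [DecidableEq ι] {u : Matrix κ κ Q} {v : Matrix ι ι Q}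
    (h : Equivalent u v) : IsSummand u v := by
  obtain ⟨T, S, hT, hS, h1, h2⟩ := h
  exact ⟨T, S, hT, hS, h1⟩

theorem directSum_left [DecidableEq ι] (u : Matrix κ κ Q) (v : Matrix ι ι Q) :
    IsSummand u (directSum u v) := by
  refine ⟨Matrix.fromRows 1 0, Matrix.fromCols 1 0, ?_, ?_, ?_⟩
  · rw [intertwines_iff]
    rintro (i | i) j <;> simp [CQG.directSum, Matrix.one_apply]
  · rw [intertwines_iff]
    rintro i (j | j) <;> simp [CQG.directSum, Matrix.one_apply]
  · simp [Matrix.fromCols_mul_fromRows]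

end IsSummand

theorem Equivalent.card_eq {ι κ : Type} [Fintype ι] [Fintype κ] [DecidableEq ι] [DecidableEq κ]
    {u : Matrix ι ι Q} {v : Matrix κ κ Q} (h : Equivalent u v) :
    Fintype.card ι = Fintype.card κ := by
  obtain ⟨T, S, -, -, h1, h2⟩ := h
  exact (Matrix.square_of_invertible T S h2 h1).symm

/-- Writes the comultiplication rule as a product of two matrices, one per leg, so that matrix
algebra applies to it. -/
theorem toMin_tmul_eq_mul {A B : Type u} [CStarAlgebra A] [CStarAlgebra B] (a : A) (b : B) :
    toMin (a ⊗ₜ[ℂ] b) = (toMin.comp Algebra.TensorProduct.includeLeft) a *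
      (toMin.comp Algebra.TensorProduct.includeRight) b := by
  simp [← map_mul]

section HomSpace

variable {ι κ μ : Type} [Fintype ι] [Fintype κ] [Fintype μ]

/-- The space of intertwiners. -/
def homSpace (u : Matrix ι ι Q) (v : Matrix κ κ Q) : Submodule ℂ (Matrix κ ι ℂ) where
  carrier := {T | Intertwines T u v}
  add_mem' := Intertwines.add
  zero_mem' := Intertwines.zero _ _
  smul_mem' c _ h := h.smul c

theorem intertwines_fromRows_iff {u : Matrix ι ι Q} {v : Matrix κ κ Q} {w : Matrix μ μ Q}
    {T : Matrix κ ι ℂ} {S : Matrix μ ι ℂ} :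
    Intertwines (Matrix.fromRows T S) u (directSum v w) ↔
      Intertwines T u v ∧ Intertwines S u w := by
  simp [intertwines_iff, directSum]

/-- Intertwiners into a direct sum. -/
def homSpaceDirectSum (u : Matrix ι ι Q) (v : Matrix κ κ Q) (w : Matrix μ μ Q) :
    (homSpace u v × homSpace u w) ≃ₗ[ℂ] homSpace u (directSum v w) where
  toFun X := ⟨Matrix.fromRows X.1.1 X.2.1, intertwines_fromRows_iff.2 ⟨X.1.2, X.2.2⟩⟩
  invFun X :=
    have h : Intertwines (Matrix.fromRows X.1.toRows₁ X.1.toRows₂) u (directSum v w) := by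
      rw [Matrix.fromRows_toRows]; exact X.2
    (⟨X.1.toRows₁, (intertwines_fromRows_iff.1 h).1⟩,
      ⟨X.1.toRows₂, (intertwines_fromRows_iff.1 h).2⟩)
  map_add' X Y := Subtype.ext (by ext (i | i) j <;> rfl)
  map_smul' c X := Subtype.ext (by ext (i | i) j <;> rfl)
  left_inv X := rfl
  right_inv X := Subtype.ext (Matrix.fromRows_toRows _)

end HomSpace

/-! ### Complete reducibility and Schur's lemma -/

namespace FinRep

/-- The comultiplication of a representation, in matrix form. -/
theorem map_comul (u : FinRep G) : u.mat.map G.Δ =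
    u.mat.map (toMin.comp Algebra.TensorProduct.includeLeft : Q →ₐ[ℂ] MinTensor Q Q) *
      u.mat.map (toMin.comp Algebra.TensorProduct.includeRight : Q →ₐ[ℂ] MinTensor Q Q) := by
  ext i j
  simp only [Matrix.map_apply, u.comul, Matrix.mul_apply, toMin_tmul_eq_mul]

theorem map_scalar_map {A B F : Type*} {ι κ : Type} [Semiring A] [Semiring B]
    [Algebra ℂ A] [Algebra ℂ B]
    [FunLike F A B] [AlgHomClass F ℂ A B] (f : F) (T : Matrix κ ι ℂ) :
    (T.map (algebraMap ℂ A)).map f = T.map (algebraMap ℂ B) := by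
  ext i j
  simp [AlgHomClass.commutes]

/-- The conjugate of a representation by a unitary scalar matrix. -/
def conj (u : FinRep G) (U : Matrix u.ι u.ι ℂ) (hU : U ∈ unitary (Matrix u.ι u.ι ℂ)) :
    FinRep G where
  ι := u.ι
  mat := (star U).map (algebraMap ℂ Q) * u.mat * U.map (algebraMap ℂ Q)
  mem_unitary := by
    have h : ∀ V ∈ unitary (Matrix u.ι u.ι ℂ), V.map (algebraMap ℂ Q) ∈
        unitary (Matrix u.ι u.ι Q) := fun V hV => by
      have e : star (V.map (algebraMap ℂ Q)) = (star V).map (algebraMap ℂ Q) := by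
        rw [Matrix.star_eq_conjTranspose, Matrix.star_eq_conjTranspose,
          ← Matrix.conjTranspose_map _ (fun x => by exact (algebraMap_star_comm x))]
      rw [Unitary.mem_iff, e, ← Matrix.map_mul, ← Matrix.map_mul, (Unitary.mem_iff.1 hV).1,
        (Unitary.mem_iff.1 hV).2]
      simp
    exact mul_mem (mul_mem (h _ (Unitary.star_mem hU)) u.mem_unitary) (h _ hU)
  comul := by
    set V := star U with hV
    have hUV : U.map (algebraMap ℂ (MinTensor Q Q)) * V.map (algebraMap ℂ (MinTensor Q Q)) = 1 := by
      rw [← Matrix.map_mul, (Unitary.mem_iff.1 hU).2]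
      simp
    have key : (V.map (algebraMap ℂ Q) * u.mat * U.map (algebraMap ℂ Q)).map G.Δ =
        (V.map (algebraMap ℂ Q) * u.mat * U.map (algebraMap ℂ Q)).map
          (toMin.comp Algebra.TensorProduct.includeLeft : Q →ₐ[ℂ] MinTensor Q Q) *
        (V.map (algebraMap ℂ Q) * u.mat * U.map (algebraMap ℂ Q)).map
          (toMin.comp Algebra.TensorProduct.includeRight : Q →ₐ[ℂ] MinTensor Q Q) := by
      simp only [Matrix.map_mul, map_scalar_map, map_comul]
      simp only [Matrix.mul_assoc]
      -- The scalar factors meeting between the two legs are U and its inverse, and cancel.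
      rw [← Matrix.mul_assoc (U.map _) (V.map _), hUV, Matrix.one_mul]
    intro i j
    have := congrFun (congrFun key i) j
    simpa only [Matrix.map_apply, Matrix.mul_apply (M := Matrix.map _ _), toMin_tmul_eq_mul]
      using this

theorem conj_intertwines (u : FinRep G) (U : Matrix u.ι u.ι ℂ)
    (hU : U ∈ unitary (Matrix u.ι u.ι ℂ)) : Intertwines U (u.conj U hU).mat u.mat := by
  change U.map (algebraMap ℂ Q) * ((star U).map (algebraMap ℂ Q) * u.mat * U.map (algebraMap ℂ Q))
    = u.mat * U.map (algebraMap ℂ Q)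
  rw [← Matrix.mul_assoc, ← Matrix.mul_assoc, ← Matrix.map_mul, (Unitary.mem_iff.1 hU).2]
  simp

theorem conj_equivalent (u : FinRep G) (U : Matrix u.ι u.ι ℂ)
    (hU : U ∈ unitary (Matrix u.ι u.ι ℂ)) : Equivalent (u.conj U hU).mat u.mat :=
  ⟨U, (star U : Matrix u.ι u.ι ℂ), u.conj_intertwines U hU,
    (u.conj_intertwines U hU).conjTranspose (u.conj U hU).mem_unitary u.mem_unitary,
    (Unitary.mem_iff.1 hU).1, (Unitary.mem_iff.1 hU).2⟩

/-- The block of a block diagonal representation. -/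
def restrict (u : FinRep G) (p : u.ι → Prop) [DecidablePred p]
    (h : ∀ i j, ¬ (p i ↔ p j) → u.mat i j = 0) : FinRep G where
  ι := {i // p i}
  mat := u.mat.submatrix (↑) (↑)
  mem_unitary := by
    have e1 : ∀ f : u.ι → Q, (∀ k, ¬ p k → f k = 0) → ∑ k : {k // p k}, f k = ∑ k, f k :=
      fun f hf => by
        rw [← Fintype.sum_subtype_add_sum_subtype p f]
        rw [Finset.sum_eq_zero (s := Finset.univ) (f := fun i : {k // ¬ p k} => f i)
          (fun k _ => hf k k.2), add_zero]
    obtain ⟨h1, h2⟩ := Unitary.mem_iff.1 u.mem_unitary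
    rw [Unitary.mem_iff]
    constructor
    · ext i j
      have := congrFun (congrFun h1 i) j
      simp only [Matrix.mul_apply, Matrix.star_apply] at this ⊢
      refine (e1 (fun k => star (u.mat k i) * u.mat k j) fun k hk => ?_).trans (this.trans ?_)
      · rw [h k j (by simp [hk, j.2]), mul_zero]
      · simp [Matrix.one_apply, Subtype.ext_iff]
    · ext i j
      have := congrFun (congrFun h2 i) j
      simp only [Matrix.mul_apply, Matrix.star_apply] at this ⊢
      refine (e1 (fun k => u.mat i k * star (u.mat j k)) fun k hk => ?_).trans (this.trans ?_)
      · rw [h i k (by simp [hk, i.2]), zero_mul]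
      · simp [Matrix.one_apply, Subtype.ext_iff]
  comul i j := by
    simp only [Matrix.submatrix_apply]
    rw [u.comul, ← Fintype.sum_subtype_add_sum_subtype p]
    rw [Finset.sum_eq_zero (s := Finset.univ) (f := fun k : {k // ¬ p k} =>
      toMin (u.mat i k ⊗ₜ[ℂ] u.mat k j)) (fun k _ => ?_), add_zero]
    rw [h i k (by simp [k.2, i.2]), TensorProduct.zero_tmul, map_zero]

theorem restrict_add_equivalent (u : FinRep G) (p : u.ι → Prop) [DecidablePred p]
    (h : ∀ i j, ¬ (p i ↔ p j) → u.mat i j = 0) :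
    Equivalent ((u.restrict p h).add (u.restrict (fun i => ¬ p i)
      (fun i j hij => h i j (fun h' => hij (not_congr h'))))).mat u.mat := by
  refine Equivalent.of_equiv (Equiv.sumCompl p) ?_
  rintro (i | i) (j | j)
  · rfl
  · exact h i.1 j.1 fun h' => j.2 (h'.1 i.2)
  · exact h i.1 j.1 fun h' => i.2 (h'.2 j.2)
  · rfl

/-- A representation with a non-scalar self-adjoint endomorphism is a nontrivial direct sum. -/
theorem exists_split_of_isHermitian (u : FinRep G) {N : Matrix u.ι u.ι ℂ} (hN : N.IsHermitian)
    (hNu : Intertwines N u.mat u.mat) (hns : ∀ c : ℂ, N ≠ c • 1) :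
    ∃ v w : FinRep G, Nonempty v.ι ∧ Nonempty w.ι ∧ Equivalent (v.add w).mat u.mat := by
  let U : Matrix u.ι u.ι ℂ := hN.eigenvectorUnitary
  have hU : U ∈ unitary (Matrix u.ι u.ι ℂ) := hN.eigenvectorUnitary.2
  obtain ⟨hU1, hU2⟩ := Unitary.mem_iff.1 hU
  let d : u.ι → ℂ := fun i => hN.eigenvalues i
  have hNd : N = U * Matrix.diagonal d * star U := hN.spectral_theorem
  let u' := u.conj U hU
  have hD : Intertwines (Matrix.diagonal d) u'.mat u'.mat := by
    have h1 := u.conj_intertwines U hU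
    have h2 := (h1.conjTranspose u'.mem_unitary u.mem_unitary).comp (hNu.comp h1)
    have e : U.conjTranspose * (N * U) = Matrix.diagonal d := by
      rw [← Matrix.star_eq_conjTranspose, hNd, Matrix.mul_assoc _ _ U, hU1, Matrix.mul_one,
        ← Matrix.mul_assoc, hU1, Matrix.one_mul]
    have h3 : ∀ X : Matrix u.ι u.ι ℂ, U.conjTranspose * (N * U) = X →
        Intertwines X u'.mat u'.mat := by
      rintro _ rfl
      exact h2
    exact h3 _ e
  -- In an eigenbasis of N the intertwining relation reads (d i − d j) u'ᵢⱼ = 0, so u' is block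
  -- diagonal along the eigenspaces.
  have hzero : ∀ i j, d i ≠ d j → u'.mat i j = 0 := fun i j hij => by
    have := intertwines_iff.1 hD i j
    simp only [Matrix.diagonal_apply, ite_smul, zero_smul, Finset.sum_ite_eq, Finset.sum_ite_eq',
      Finset.mem_univ, if_true] at this
    rw [← sub_eq_zero, ← sub_smul] at this
    exact (smul_eq_zero.1 this).resolve_left (sub_ne_zero.2 hij)
  obtain ⟨i, j, hij⟩ : ∃ i j, d i ≠ d j := by
    by_contra! hd
    rcases isEmpty_or_nonempty u.ι with he | ⟨⟨i⟩⟩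
    · exact hns 0 (Subsingleton.elim _ _)
    · refine hns (d i) ?_
      have : Matrix.diagonal d = d i • (1 : Matrix u.ι u.ι ℂ) := by
        rw [Matrix.smul_one_eq_diagonal]
        exact congrArg _ (funext fun j => hd j i)
      rw [hNd, this, Matrix.mul_smul, Matrix.smul_mul, Matrix.mul_one, hU2]
  classical
  refine ⟨_, _, ?_, ?_, (u'.restrict_add_equivalent (fun k => d k = d i)
    (fun k l hkl => hzero k l fun h => hkl (by rw [h]))).trans (u.conj_equivalent U hU)⟩
  · exact ⟨⟨i, rfl⟩⟩
  · exact ⟨⟨j, hij.symm⟩⟩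

/-- If both T + T* and i(T − T*) were scalar, so would be T; hence one of these self-adjoint
endomorphisms is non-scalar. -/
theorem exists_split_of_not_scalar (u : FinRep G) {T : Matrix u.ι u.ι ℂ}
    (hT : Intertwines T u.mat u.mat) (hns : ∀ c : ℂ, T ≠ c • 1) :
    ∃ v w : FinRep G, Nonempty v.ι ∧ Nonempty w.ι ∧ Equivalent (v.add w).mat u.mat := by
  have hT' := hT.conjTranspose u.mem_unitary u.mem_unitary
  by_cases h : ∀ c : ℂ, T + T.conjTranspose ≠ c • 1
  · refine u.exists_split_of_isHermitian ?_ (hT.add hT') h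
    rw [Matrix.IsHermitian, Matrix.conjTranspose_add, Matrix.conjTranspose_conjTranspose, add_comm]
  · push Not at h
    obtain ⟨c, hc⟩ := h
    -- The scalar comes from T = ½((T + T*) − i · i(T − T*)).
    refine u.exists_split_of_isHermitian (N := Complex.I • (T + (-1 : ℂ) • T.conjTranspose)) ?_
      ((hT.add (hT'.smul _)).smul _) fun c' hc' => hns ((c - Complex.I * c') / 2) ?_
    · rw [Matrix.IsHermitian, Matrix.conjTranspose_smul, Matrix.conjTranspose_add,
        Matrix.conjTranspose_smul, Matrix.conjTranspose_conjTranspose]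
      simp only [Complex.star_def, Complex.conj_I, map_neg, map_one]
      module
    · have e : T = (1 / 2 : ℂ) • ((T + T.conjTranspose) - Complex.I •
          (Complex.I • (T + (-1 : ℂ) • T.conjTranspose))) := by
        rw [smul_smul, Complex.I_mul_I]
        module
      rw [e, hc, hc']
      module

theorem surjective_card_le (u w : FinRep G) (T : Matrix u.ι w.ι ℂ)
    (h : Function.Surjective T.mulVec) : Fintype.card u.ι ≤ Fintype.card w.ι := by
  have := LinearMap.finrank_le_finrank_of_surjective (f := T.mulVecLin) h
  simpa using this

/-- Schur's lemma for endomorphisms. -/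
theorem IsIrreducible.eq_smul_one {u : FinRep G} (hu : u.IsIrreducible) {T : Matrix u.ι u.ι ℂ}
    (hT : Intertwines T u.mat u.mat) : ∃ c : ℂ, T = c • 1 := by
  by_contra! h
  obtain ⟨v, w, hv, hw, he⟩ := u.exists_split_of_not_scalar hT h
  -- The summand `v` embeds as a nonzero subrepresentation of strictly smaller dimension,
  -- contradicting irreducibility.
  obtain ⟨S, R, hS, hR, hRS⟩ := (IsSummand.directSum_left v.mat w.mat).trans (.of_equivalent he)
  have hinj : Function.Injective S.mulVec := Function.LeftInverse.injective (g := R.mulVec)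
    fun x => by rw [Matrix.mulVec_mulVec, hRS, Matrix.one_mulVec]
  rcases hu.2 v S hS hinj with h | h
  · exact h.elim hv.some
  · have h1 := surjective_card_le u v S h
    have h2 : Fintype.card (v.ι ⊕ w.ι) = Fintype.card u.ι := he.card_eq
    rw [Fintype.card_sum] at h2
    have := Fintype.card_pos (α := w.ι)
    omega

/-- A nonzero representation is irreducible or a nontrivial direct sum. -/
theorem exists_split_of_not_isIrreducible (u : FinRep G) [Nonempty u.ι]
    (hu : ¬ u.IsIrreducible) :
    ∃ v w : FinRep G, Nonempty v.ι ∧ Nonempty w.ι ∧ Equivalent (v.add w).mat u.mat := by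
  rw [IsIrreducible, not_and] at hu
  have hu := hu inferInstance
  push Not at hu
  obtain ⟨w, T, hT, hinj, hw, hsurj⟩ := hu
  -- The endomorphism TT* is not scalar: TT* = 0 would force T = 0, against injectivity on a nonzero
  -- space, and TT* = c ≠ 0 would make T surjective.
  refine u.exists_split_of_not_scalar
    (hT.comp (hT.conjTranspose w.mem_unitary u.mem_unitary)) fun c hc => ?_
  rcases eq_or_ne c 0 with rfl | h0
  · rw [zero_smul, Matrix.self_mul_conjTranspose_eq_zero] at hc
    subst hc
    have : (Pi.single hw.some 1 : w.ι → ℂ) = 0 := hinj (by simp only [Matrix.zero_mulVec])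
    simpa using congrFun this hw.some
  · refine hsurj fun x => ⟨T.conjTranspose.mulVec (c⁻¹ • x), ?_⟩
    rw [Matrix.mulVec_mulVec, hc, Matrix.smul_mulVec, Matrix.one_mulVec, smul_inv_smul₀ h0]

/-- Complete reducibility. -/
theorem exists_multiset (u : FinRep G) : ∃ m : Multiset (RepClass G),
    (∀ c ∈ m, ∃ w : FinRep G, RepClass.mk w = c ∧ w.IsIrreducible ∧ IsSummand w.mat u.mat) ∧
      m.sum = RepClass.mk u := by
  -- Induction on the dimension. The summand relation is carried along because torsion is expressed
  -- through summands of tensor powers.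
  induction hn : Fintype.card u.ι using Nat.strong_induction_on generalizing u with
  | _ n ih =>
    subst hn
    rcases isEmpty_or_nonempty u.ι with he | hne
    · exact ⟨0, by simp, RepClass.sound_equiv (u := zero G) (v := u)
        (Equiv.equivOfIsEmpty Empty u.ι) fun i => i.elim⟩
    by_cases hu : u.IsIrreducible
    · exact ⟨{RepClass.mk u}, by
        simpa using ⟨u, rfl, hu, .of_equivalent (.refl u.mat)⟩, by simp⟩
    obtain ⟨v, w, hv, hw, he⟩ := u.exists_split_of_not_isIrreducible hu
    have hcard : Fintype.card (v.ι ⊕ w.ι) = Fintype.card u.ι := he.card_eq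
    rw [Fintype.card_sum] at hcard
    have := Fintype.card_pos (α := v.ι)
    have := Fintype.card_pos (α := w.ι)
    obtain ⟨m, hm, hms⟩ := ih _ (by omega) v rfl
    obtain ⟨m', hm', hms'⟩ := ih _ (by omega) w rfl
    refine ⟨m + m', fun c hc => ?_, ?_⟩
    · rcases Multiset.mem_add.1 hc with hc | hc
      · obtain ⟨x, rfl, hx, hs⟩ := hm c hc
        exact ⟨x, rfl, hx, hs.trans ((IsSummand.directSum_left v.mat w.mat).trans
          (.of_equivalent he))⟩
      · obtain ⟨x, rfl, hx, hs⟩ := hm' c hc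
        refine ⟨x, rfl, hx, hs.trans ((IsSummand.directSum_left w.mat v.mat).trans
          (.of_equivalent (Equivalent.trans ?_ he)))⟩
        exact Equivalent.of_equiv (Equiv.sumComm w.ι v.ι) (by rintro (i | i) (j | j) <;> rfl)
    · rw [Multiset.sum_add, hms, hms', RepClass.mk_add]
      exact RepClass.sound he

/-- Schur's lemma. -/
theorem IsIrreducible.mk_eq_mk {u v : FinRep G} (hu : u.IsIrreducible) (hv : v.IsIrreducible)
    {T : Matrix v.ι u.ι ℂ} (hT : Intertwines T u.mat v.mat) (h0 : T ≠ 0) :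
    RepClass.mk u = RepClass.mk v := by
  have hT' := hT.conjTranspose u.mem_unitary v.mem_unitary
  -- T*T = a and TT* = b are scalar, and aT = TT*T = bT shows a = b, so a⁻¹T* is a two-sided inverse
  -- of T.
  obtain ⟨a, ha⟩ := hu.eq_smul_one (hT'.comp hT)
  obtain ⟨b, hb⟩ := hv.eq_smul_one (hT.comp hT')
  have ha0 : a ≠ 0 := by
    rintro rfl
    rw [zero_smul, Matrix.conjTranspose_mul_self_eq_zero] at ha
    exact h0 ha
  have hab : a = b := by
    have h : a • T = b • T := by
      rw [← Matrix.mul_one (a • T), Matrix.smul_mul, ← Matrix.mul_smul, ← ha, ← Matrix.mul_assoc,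
        hb, Matrix.smul_mul, Matrix.one_mul]
    exact smul_left_injective ℂ h0 h
  refine RepClass.sound ⟨T, a⁻¹ • T.conjTranspose, hT, hT'.smul _, ?_, ?_⟩
  · rw [Matrix.smul_mul, ha, inv_smul_smul₀ ha0]
  · rw [Matrix.mul_smul, hb, ← hab, inv_smul_smul₀ ha0]

/-- The dimension of the space of intertwiners. -/
def homDim (u v : FinRep G) : ℕ := Module.finrank ℂ (homSpace u.mat v.mat)

theorem homDim_congr (u : FinRep G) {v w : FinRep G} (h : Equivalent v.mat w.mat) :
    homDim u v = homDim u w := by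
  obtain ⟨T, S, hT, hS, h1, h2⟩ := h
  refine LinearEquiv.finrank_eq
    { toFun := fun X => ⟨T * X.1, hT.comp X.2⟩
      invFun := fun X => ⟨S * X.1, hS.comp X.2⟩
      map_add' := fun X Y => Subtype.ext (Matrix.mul_add _ _ _)
      map_smul' := fun c X => Subtype.ext (Matrix.mul_smul _ _ _)
      left_inv := fun X => Subtype.ext ?_
      right_inv := fun X => Subtype.ext ?_ }
  · change S * (T * X.1) = X.1
    rw [← Matrix.mul_assoc, h1, Matrix.one_mul]
  · change T * (S * X.1) = X.1
    rw [← Matrix.mul_assoc, h2, Matrix.one_mul]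

theorem homDim_add (u v w : FinRep G) : homDim u (v.add w) = homDim u v + homDim u w := by
  rw [homDim, homDim, homDim, ← Module.finrank_prod]
  exact (homSpaceDirectSum u.mat v.mat w.mat).finrank_eq.symm

theorem homDim_zero (u : FinRep G) : homDim u (zero G) = 0 := by
  have : Subsingleton (Matrix (zero G).ι u.ι ℂ) := ⟨fun a b => by ext i; exact i.elim⟩
  exact Module.finrank_zero_of_subsingleton

theorem IsIrreducible.homDim_self {u : FinRep G} (hu : u.IsIrreducible) : homDim u u = 1 := by
  have h : homSpace u.mat u.mat = Submodule.span ℂ {(1 : Matrix u.ι u.ι ℂ)} := by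
    ext T
    rw [Submodule.mem_span_singleton]
    constructor
    · intro hT
      obtain ⟨c, hc⟩ := hu.eq_smul_one hT
      exact ⟨c, hc.symm⟩
    · rintro ⟨c, rfl⟩
      exact (intertwines_one u.mat).smul c
  have := hu.1
  rw [homDim, h, finrank_span_singleton one_ne_zero]

theorem IsIrreducible.homDim_eq_zero {u v : FinRep G} (hu : u.IsIrreducible)
    (hv : v.IsIrreducible) (h : RepClass.mk u ≠ RepClass.mk v) : homDim u v = 0 := by
  have h : homSpace u.mat v.mat = ⊥ := by
    rw [Submodule.eq_bot_iff]
    intro T hT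
    by_contra h0
    exact h (hu.mk_eq_mk hv hT h0)
  rw [homDim, h, finrank_bot]

end FinRep

/-! ### Multiplicities determine the class -/

namespace RepClass

/-- The multiplicity `dim Hom(u, ·)`. -/
def homDim (u : FinRep G) : RepClass G →+ ℕ where
  toFun := Quotient.lift (FinRep.homDim u) fun _ _ h => u.homDim_congr h
  map_zero' := u.homDim_zero
  map_add' a b := by
    induction a using ind with | h v =>
    induction b using ind with | h w =>
    exact u.homDim_add v w

theorem homDim_mk (u v : FinRep G) : homDim u (mk v) = u.homDim v := rfl

/-- Hom(u, ·) is additive, and by Schur's lemma each irreducible constituent contributes 1 if it is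
equivalent to `u` and 0 otherwise. -/
theorem homDim_sum {u : FinRep G} (hu : u.IsIrreducible) (m : Multiset (RepClass G))
    (hm : ∀ c ∈ m, ∃ w : FinRep G, mk w = c ∧ w.IsIrreducible) [DecidableEq (RepClass G)] :
    homDim u m.sum = m.count (mk u) := by
  induction m using Multiset.induction_on with
  | empty => simp
  | cons c m ih =>
    obtain ⟨w, rfl, hw⟩ := hm c (Multiset.mem_cons_self _ _)
    rw [Multiset.sum_cons, map_add, ih fun c hc => hm c (Multiset.mem_cons_of_mem hc),
      Multiset.count_cons, add_comm, homDim_mk]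
    split_ifs with h
    · rw [← u.homDim_congr (Quotient.exact h), hu.homDim_self]
    · rw [hu.homDim_eq_zero hw h]

/-- The multiplicities of the irreducible representations determine the equivalence class. -/
theorem ext_homDim {a b : RepClass G}
    (h : ∀ u : FinRep G, u.IsIrreducible → homDim u a = homDim u b) : a = b := by
  classical
  induction a using ind with | h v =>
  induction b using ind with | h w =>
  obtain ⟨m, hm, hms⟩ := v.exists_multiset
  obtain ⟨m', hm', hms'⟩ := w.exists_multiset
  rw [← hms, ← hms'] at h ⊢
  have k : ∀ c ∈ m, ∃ w : FinRep G, mk w = c ∧ w.IsIrreducible := fun c hc =>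
    (hm c hc).imp fun w hw => ⟨hw.1, hw.2.1⟩
  have k' : ∀ c ∈ m', ∃ w : FinRep G, mk w = c ∧ w.IsIrreducible := fun c hc =>
    (hm' c hc).imp fun w hw => ⟨hw.1, hw.2.1⟩
  -- The multisets of constituents themselves agree: counts at irreducible classes are
  -- multiplicities, and the other classes occur in neither.
  congr 1
  ext c
  by_cases hc : ∃ u : FinRep G, mk u = c ∧ u.IsIrreducible
  · obtain ⟨u, rfl, hu⟩ := hc
    rw [← homDim_sum hu m k, ← homDim_sum hu m' k', h u hu]
  · rw [Multiset.count_eq_zero_of_notMem fun hm => hc (k c hm),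
      Multiset.count_eq_zero_of_notMem fun hm => hc (k' c hm)]

end RepClass

/-! ### The fusion ring -/

namespace FusionRing

/-- The canonical map of the semiring of classes of representations into the fusion ring. -/
def of : RepClass G →+* FusionRing G :=
  (Algebra.TensorProduct.includeRight : RepClass G →ₐ[ℕ] ℤ ⊗[ℕ] RepClass G).toRingHom

/-- The extension of a semiring homomorphism to the fusion ring. -/
def lift {R : Type*} [Ring R] (f : RepClass G →+* R) : FusionRing G →+* R :=
  (Algebra.TensorProduct.lift (Int.castRingHom R).toNatAlgHom f.toNatAlgHom
    (fun n _ => Int.cast_commute n _) : ℤ ⊗[ℕ] RepClass G →ₐ[ℕ] R).toRingHom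

@[simp] theorem lift_of {R : Type*} [Ring R] (f : RepClass G →+* R) (c : RepClass G) :
    lift f (of c) = f c :=
  (Algebra.TensorProduct.lift_tmul (Int.castRingHom R).toNatAlgHom f.toNatAlgHom
    (fun n _ => Int.cast_commute n _) 1 c).trans (by simp)

/-- The extension of an additive map to the fusion ring. -/
def liftAdd (f : RepClass G →+ ℕ) : FusionRing G →+ ℤ :=
  (TensorProduct.lift (((LinearMap.mul ℕ ℤ).flip.comp
    ((Nat.castAddMonoidHom ℤ).comp f).toNatLinearMap).flip) :
      ℤ ⊗[ℕ] RepClass G →ₗ[ℕ] ℤ).toAddMonoidHom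

@[simp] theorem liftAdd_of (f : RepClass G →+ ℕ) (c : RepClass G) :
    liftAdd f (of c) = f c := by
  change TensorProduct.lift (((LinearMap.mul ℕ ℤ).flip.comp
    ((Nat.castAddMonoidHom ℤ).comp f).toNatLinearMap).flip) ((1 : ℤ) ⊗ₜ[ℕ] c) = f c
  simp

/-- Multiplicities extend to additive maps from the fusion ring to ℤ and already separate classes,
so nothing collapses in the Grothendieck construction. -/
theorem of_injective : Function.Injective (of : RepClass G → FusionRing G) := fun a b h =>
  RepClass.ext_homDim fun u _ => by
    have := congrArg (liftAdd (RepClass.homDim u)) h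
    simpa using this

theorem exists_eq_sub (x : FusionRing G) : ∃ a b : RepClass G, x = of a - of b := by
  have h : ∀ x : ℤ ⊗[ℕ] RepClass G, ∃ a b : RepClass G,
      x + (1 : ℤ) ⊗ₜ[ℕ] b = (1 : ℤ) ⊗ₜ[ℕ] a := fun x => by
    induction x using TensorProduct.induction_on with
    | zero => exact ⟨0, 0, by simp⟩
    | add x y hx hy =>
      obtain ⟨a, b, h⟩ := hx
      obtain ⟨a', b', h'⟩ := hy
      refine ⟨a + a', b + b', ?_⟩
      rw [TensorProduct.tmul_add, TensorProduct.tmul_add, ← h, ← h']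
      abel
    | tmul n c =>
      have e : ∀ k : ℕ, (1 : ℤ) ⊗ₜ[ℕ] (k • c) = (k : ℤ) ⊗ₜ[ℕ] c := fun k => by
        rw [← TensorProduct.smul_tmul]
        simp
      -- The positive and negative parts of the integer coefficient.
      refine ⟨n.toNat • c, (-n).toNat • c, ?_⟩
      rw [e, e, ← TensorProduct.add_tmul]
      congr 1
      omega
  obtain ⟨a, b, h⟩ := h x
  exact ⟨a, b, eq_sub_of_add_eq h⟩

end FusionRing

/-! ### Weakly irreducible quantum groups are connected -/

namespace RepClass

/-- The dimension of a representation. -/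
def dim : RepClass G →+* ℕ where
  toFun := Quotient.lift (fun u : FinRep G => Fintype.card u.ι) fun _ _ h => h.card_eq
  map_zero' := Fintype.card_empty
  map_one' := Fintype.card_unit
  map_add' a b := by
    induction a using ind with | h v =>
    induction b using ind with | h w =>
    exact Fintype.card_sum (α := v.ι) (β := w.ι)
  map_mul' a b := by
    induction a using ind with | h v =>
    induction b using ind with | h w =>
    exact Fintype.card_prod v.ι w.ι

theorem dim_mk (u : FinRep G) : dim (mk u) = Fintype.card u.ι := rfl

end RepClass

/-- In a domain with an augmentation to `ℤ`, the integral elements are the integers. -/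
theorem eq_intCast_of_isIntegral {R : Type*} [Ring R] [IsDomain R] (ε : R →+* ℤ) {x : R}
    (hx : IsIntegral ℤ x) : x = (ε x : R) := by
  obtain ⟨p, hp, hpx⟩ := hx
  -- Split off the full power of X − ε(x) from the monic p. In a domain one factor kills x; it
  -- cannot be q, since applying ε would make ε(x) a root of q.
  obtain ⟨q, hq, hdvd⟩ := p.exists_eq_pow_rootMultiplicity_mul_and_not_dvd hp.ne_zero (ε x)
  have h : Polynomial.aeval x p = 0 := hpx
  rw [hq, map_mul, map_pow, map_sub, Polynomial.aeval_X, Polynomial.aeval_C] at h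
  rcases mul_eq_zero.1 h with h | h
  · simpa using sub_eq_zero.1 (eq_zero_of_pow_eq_zero h)
  · refine absurd ?_ hdvd
    rw [Polynomial.dvd_iff_isRoot, Polynomial.IsRoot.def]
    have h' := congrArg ε.toIntAlgHom h
    rw [← Polynomial.aeval_algHom_apply, map_zero] at h'
    rwa [Polynomial.coe_aeval_eq_eval] at h'

theorem isSummand_of_block {ι κ : Type} [Fintype ι] [Fintype κ] [DecidableEq ι] [DecidableEq κ]
    {u : Matrix ι ι Q} {v : Matrix κ κ Q} (f : ι → κ) (hf : Function.Injective f)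
    (h : ∀ i j, v (f i) (f j) = u i j) (hl : ∀ k ∉ Set.range f, ∀ i, v k (f i) = 0)
    (hr : ∀ k ∉ Set.range f, ∀ i, v (f i) k = 0) : IsSummand u v := by
  refine ⟨Matrix.of fun k i => if k = f i then 1 else 0,
    Matrix.of fun i k => if k = f i then 1 else 0, ?_, ?_, ?_⟩
  · rw [intertwines_iff]
    intro k j
    by_cases hk : k ∈ Set.range f
    · obtain ⟨i, rfl⟩ := hk
      simp [h, hf.eq_iff]
    · have : ∀ i, k ≠ f i := fun i hi => hk ⟨i, hi.symm⟩
      simp [this, hl k hk]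
  · rw [intertwines_iff]
    intro i k
    by_cases hk : k ∈ Set.range f
    · obtain ⟨j, rfl⟩ := hk
      simp [h, hf.eq_iff]
    · have : ∀ i, k ≠ f i := fun i hi => hk ⟨i, hi.symm⟩
      simp [this, hr k hk]
  · ext i j
    simp [Matrix.mul_apply, Matrix.one_apply, hf.eq_iff, eq_comm]

/-- Multi-indices with all letters from `u` form a block: if p contains a letter from `v` and q does
not, some factor is an off-diagonal zero of the direct sum. Since `v` is an arbitrary matrix, this
covers the dual, which is not assumed unitary. -/
theorem isSummand_tensorPow_directSum {ι κ : Type} [Fintype ι] [Fintype κ] [DecidableEq ι]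
    [DecidableEq κ] (n : ℕ) (u : Matrix ι ι Q) (v : Matrix κ κ Q) :
    IsSummand (tensorPow n u) (tensorPow n (directSum u v)) := by
  have hz : ∀ p : Fin n → ι ⊕ κ, p ∉ Set.range (fun (q : Fin n → ι) k => Sum.inl (q k)) →
      ∃ k x, p k = Sum.inr x := fun p hp => by
    by_contra! h
    have h' : ∀ k, ∃ i, p k = Sum.inl i := fun k => by
      rcases hk : p k with i | x
      · exact ⟨i, rfl⟩
      · exact absurd hk (h k x)
    choose q hq using h'
    exact hp ⟨q, funext fun k => (hq k).symm⟩
  refine isSummand_of_block (fun q k => Sum.inl (q k))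
    (fun p q h => funext fun k => Sum.inl_injective (congrFun h k)) (fun p q => rfl)
    (fun p hp q => ?_) (fun p hp q => ?_)
  · obtain ⟨k, x, hk⟩ := hz p hp
    exact List.prod_eq_zero (List.mem_ofFn.2 ⟨k, by simp [hk, directSum]⟩)
  · obtain ⟨k, x, hk⟩ := hz p hp
    exact List.prod_eq_zero (List.mem_ofFn.2 ⟨k, by simp [hk, directSum]⟩)

namespace FinRep

/-- The tensor powers of a representation. -/
def pow (u : FinRep G) : ℕ → FinRep G
  | 0 => trivial G
  | n + 1 => u.mul (u.pow n)

theorem mk_pow (u : FinRep G) (n : ℕ) : RepClass.mk (u.pow n) = RepClass.mk u ^ n := by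
  induction n with
  | zero => rw [pow_zero]; rfl
  | succ n ih => rw [pow_succ', ← ih]; rfl

theorem pow_equivalent (u : FinRep G) (n : ℕ) :
    Equivalent (u.pow n).mat (tensorPow n u.mat) := by
  suffices h : ∃ e : (u.pow n).ι ≃ (Fin n → u.ι),
      ∀ i j, tensorPow n u.mat (e i) (e j) = (u.pow n).mat i j by
    obtain ⟨e, he⟩ := h
    exact .of_equiv e he
  induction n with
  | zero => exact ⟨(Equiv.ofUnique Unit (Fin 0 → u.ι)), fun i j => rfl⟩
  | succ n ih =>
    obtain ⟨e, he⟩ := ih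
    refine ⟨(Equiv.prodCongr (Equiv.refl u.ι) e).trans (Fin.consEquiv fun _ => u.ι), ?_⟩
    rintro ⟨i, k⟩ ⟨j, l⟩
    change _ = u.mat i j * (u.pow n).mat k l
    rw [← he]
    change (List.ofFn fun a => u.mat ((Fin.cons i (e k) : Fin (n + 1) → u.ι) a)
      ((Fin.cons j (e l) : Fin (n + 1) → u.ι) a)).prod = _
    rw [List.ofFn_succ, List.prod_cons]
    rfl

theorem trivial_isIrreducible : (trivial G).IsIrreducible := by
  refine ⟨⟨()⟩, fun w T hT hinj => ?_⟩
  rcases isEmpty_or_nonempty w.ι with h | ⟨⟨i⟩⟩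
  · exact .inl h
  · refine .inr fun y => ?_
    have h0 : T.mulVec (Pi.single i 1) ≠ 0 := fun h0 => by
      have : (Pi.single i 1 : w.ι → ℂ) = 0 := hinj (by rw [h0, Matrix.mulVec_zero])
      simpa using congrFun this i
    have h1 : T.mulVec (Pi.single i 1) () ≠ 0 := fun h1 => h0 (funext fun _ => h1)
    refine ⟨(y () / T.mulVec (Pi.single i 1) ()) • Pi.single i 1, funext fun _ => ?_⟩
    rw [Matrix.mulVec_smul]
    exact div_mul_cancel₀ _ h1

/-- Tensor powers of `u` are summands of those of u ⊕ u*, so their irreducible constituents lie in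
the finite set given by torsion. -/
theorem IsTorsion.isIntegral {u : FinRep G} (hu : u.IsTorsion) :
    IsIntegral ℤ (FusionRing.of (RepClass.mk u)) := by
  let C : Set (RepClass G) := {c | ∃ w : FinRep G, RepClass.mk w = c ∧ w.IsIrreducible ∧
    ∃ n : ℕ, IsSummand w.mat (tensorPow n (directSum u.mat (dual u.mat)))}
  have hC : C.Finite := hu
  let N : Submodule ℤ (FusionRing G) := Submodule.span ℤ (FusionRing.of '' C)
  have hN : N.FG := Submodule.fg_span (hC.image _)
  have hpow : ∀ n : ℕ, FusionRing.of (RepClass.mk u) ^ n ∈ N := fun n => by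
    obtain ⟨m, hm, hms⟩ := (u.pow n).exists_multiset
    rw [← map_pow, ← mk_pow, ← hms, map_multiset_sum]
    refine multiset_sum_mem _ fun x hx => ?_
    obtain ⟨c, hc, rfl⟩ := Multiset.mem_map.1 hx
    obtain ⟨w, rfl, hw, hs⟩ := hm c hc
    exact Submodule.subset_span ⟨_, ⟨w, rfl, hw, n, (hs.trans (.of_equivalent
      (u.pow_equivalent n))).trans (isSummand_tensorPow_directSum n _ _)⟩, rfl⟩
  -- The subring ℤ[[u]] is spanned by powers of [u], hence lies in the finitely generated ℤ-module
  -- `N`.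
  refine IsIntegral.of_mem_of_fg (Algebra.adjoin ℤ {FusionRing.of (RepClass.mk u)})
    (hN.of_le ?_) _ (Algebra.self_mem_adjoin_singleton ℤ _)
  rw [Algebra.adjoin_eq_span, Submodule.span_le]
  rintro x hx
  obtain ⟨n, rfl⟩ := Submonoid.mem_closure_singleton.1 hx
  exact hpow n

end FinRep

namespace CompactQuantumGroup

theorem IsWeaklyIrreducible.isConnected (hG : G.IsWeaklyIrreducible) : G.IsConnected := by
  intro u hu ht
  have : IsDomain (FusionRing G) := hG
  let ε : FusionRing G →+* ℤ := FusionRing.lift ((Nat.castRingHom ℤ).comp RepClass.dim)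
  have h := eq_intCast_of_isIntegral ε ht.isIntegral
  have hε : ε (FusionRing.of (RepClass.mk u)) = (Fintype.card u.ι : ℕ) := by
    simp [ε, RepClass.dim_mk]
  rw [hε, Int.cast_natCast, ← map_natCast (FusionRing.of (G := G))] at h
  -- From [u] = (dim u)·1, counting copies of the trivial representation gives dim Hom(1, u) = dim
  -- u, which is nonzero.
  have h1 := congrArg (RepClass.homDim (FinRep.trivial G)) (FusionRing.of_injective h)
  rw [← nsmul_one, map_nsmul, RepClass.homDim_mk, RepClass.one_def, RepClass.homDim_mk,
    FinRep.trivial_isIrreducible.homDim_self, smul_eq_mul, mul_one] at h1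
  have := hu.1
  have hne : RepClass.mk (FinRep.trivial G) = RepClass.mk u := by
    by_contra hne
    rw [FinRep.trivial_isIrreducible.homDim_eq_zero hu hne] at h1
    exact Fintype.card_ne_zero h1.symm
  exact Quotient.exact hne.symm

end CompactQuantumGroup

/-! ### Irreducible quantum groups are weakly irreducible -/

section Character

variable {ι κ : Type} [Fintype ι] [Fintype κ] [DecidableEq ι] [DecidableEq κ]

/-- The trace over a noncommutative `Q` is not cyclic in general, but scalar matrices have central
entries and may be cycled. -/
theorem Equivalent.trace_eq {u : Matrix ι ι Q} {v : Matrix κ κ Q} (h : Equivalent u v) :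
    u.trace = v.trace := by
  obtain ⟨T, S, hT, hS, h1, h2⟩ := h
  have hc : ∀ (A : Matrix ι κ ℂ) (B : Matrix κ ι Q),
      (A.map (algebraMap ℂ Q) * B).trace = (B * A.map (algebraMap ℂ Q)).trace := fun A B => by
    simp only [Matrix.trace, Matrix.diag_apply, Matrix.mul_apply, Matrix.map_apply,
      Algebra.commutes]
    exact Finset.sum_comm
  have e1 : S.map (algebraMap ℂ Q) * T.map (algebraMap ℂ Q) = 1 := by
    rw [← Matrix.map_mul, h1]; simp
  have e2 : T.map (algebraMap ℂ Q) * S.map (algebraMap ℂ Q) = 1 := by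
    rw [← Matrix.map_mul, h2]; simp
  unfold Intertwines at hT
  rw [← Matrix.one_mul u, ← e1, Matrix.mul_assoc, hc, hT, Matrix.mul_assoc, e2, Matrix.mul_one]

end Character

namespace FinRep

/-- The character of a representation. -/
def character (u : FinRep G) : Q := u.mat.trace

theorem character_add (v w : FinRep G) : (v.add w).character = v.character + w.character :=
  Fintype.sum_sum_type fun i => directSum v.mat w.mat i i

theorem character_mul (v w : FinRep G) : (v.mul w).character = v.character * w.character := by
  have h : (v.mul w).character = ∑ p : v.ι × w.ι, v.mat p.1 p.1 * w.mat p.2 p.2 := rfl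
  rw [h, Fintype.sum_prod_type, character, character, Matrix.trace, Matrix.trace,
    Finset.sum_mul_sum]
  rfl

end FinRep

namespace RepClass

/-- The character, as a homomorphism of semirings. -/
def character : RepClass G →+* Q where
  toFun := Quotient.lift FinRep.character fun _ _ h => h.trace_eq
  map_zero' := by
    change ∑ i : Empty, (1 : Matrix Empty Empty Q) i i = 0
    simp
  map_one' := by
    change ∑ i : Unit, (1 : Matrix Unit Unit Q) i i = 1
    simp
  map_add' a b := by
    induction a using ind with | h v =>
    induction b using ind with | h w =>
    exact v.character_add w
  map_mul' a b := by
    induction a using ind with | h v =>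
    induction b using ind with | h w =>
    exact v.character_mul w

theorem character_mk (u : FinRep G) : character (mk u) = u.character := rfl

theorem character_mem (c : RepClass G) : character c ∈ G.coefAlgebra := by
  induction c using ind with | h u =>
  exact sum_mem fun i _ => Submodule.subset_span ⟨u, i, i, rfl⟩

end RepClass

/-! ### Averaging with the Haar state and orthogonality -/

namespace FinRep

/-- The averaging operator `B ↦ (id ⊗ h)(u* (B ⊗ 1) z)` of a functional. -/
def average (h : Q →ₗ[ℂ] ℂ) (z u : FinRep G) : Matrix u.ι z.ι ℂ →ₗ[ℂ] Matrix u.ι z.ι ℂ where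
  toFun B := (star u.mat * B.map (algebraMap ℂ Q) * z.mat).map h
  map_add' B C := by
    rw [Matrix.map_add _ (map_add _), Matrix.mul_add, Matrix.add_mul, Matrix.map_add _ (map_add _)]
  map_smul' c B := by
    have e : (c • B).map (algebraMap ℂ Q) = c • B.map (algebraMap ℂ Q) := by
      ext i j
      simp [Algebra.smul_def]
    rw [e, Matrix.mul_smul, Matrix.smul_mul]
    ext i j
    simp

theorem average_apply (h : Q →ₗ[ℂ] ℂ) (z u : FinRep G) (B : Matrix u.ι z.ι ℂ) :
    average h z u B = (star u.mat * B.map (algebraMap ℂ Q) * z.mat).map h := rfl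

/-- With a = u*(B ⊗ 1)z one has Δ(a) = (1 ⊗ u*)(a ⊗ 1)(1 ⊗ z) entrywise. Applying h ⊗ id and
invariance gives u*Ez = E for the scalar matrix E = h(a), and multiplying by the unitary u gives Ez
= uE. -/
theorem average_mem {h : PosFun Q} (hh : ∀ a, h.sliceLeft (G.Δ a) = h a • (1 : Q))
    (z u : FinRep G) (B : Matrix u.ι z.ι ℂ) :
    Intertwines (average (h.toCLM : Q →ₗ[ℂ] ℂ) z u B) z.mat u.mat := by
  set a := star u.mat * B.map (algebraMap ℂ Q) * z.mat with ha
  let i₁ : Q →ₐ[ℂ] MinTensor Q Q := toMin.comp Algebra.TensorProduct.includeLeft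
  let i₂ : Q →ₐ[ℂ] MinTensor Q Q := toMin.comp Algebra.TensorProduct.includeRight
  have hstar : (star u.mat).map G.Δ = (star u.mat).map i₂ * (star u.mat).map i₁ := by
    have h1 : ∀ x, i₁ (star x) = star (i₁ x) := fun x => by simp [i₁, star_toMin]
    have h2 : ∀ x, i₂ (star x) = star (i₂ x) := fun x => by simp [i₂, star_toMin]
    rw [Matrix.star_eq_conjTranspose, Matrix.conjTranspose_map _ (fun x => map_star G.Δ x),
      Matrix.conjTranspose_map _ h1, Matrix.conjTranspose_map _ h2, map_comul,
      Matrix.conjTranspose_mul]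
  -- The adjoint reverses the two legs of u, so the first-leg factors of u* and z meet around B and
  -- reassemble into a.
  have hΔ : a.map G.Δ = (star u.mat).map i₂ * a.map i₁ * z.mat.map i₂ := by
    simp only [ha, Matrix.map_mul, map_scalar_map, map_comul, hstar, Matrix.mul_assoc]
    rfl
  have hE : star u.mat * (average (h.toCLM : Q →ₗ[ℂ] ℂ) z u B).map (algebraMap ℂ Q) * z.mat =
      (average (h.toCLM : Q →ₗ[ℂ] ℂ) z u B).map (algebraMap ℂ Q) := by
    ext i j
    have h1 := hh (a i j)
    have h2 : G.Δ (a i j) = ∑ s, ∑ r, i₂ (star u.mat i r) * i₁ (a r s) * i₂ (z.mat s j) := by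
      have := congrFun (congrFun hΔ i) j
      simpa only [Matrix.map_apply, Matrix.mul_apply (M := Matrix.map _ _),
        Matrix.mul_apply (M := _ * _), Finset.sum_mul] using this
    have h3 : ∀ x y b : Q, i₂ x * i₁ b * i₂ y = toMin (b ⊗ₜ (x * y)) := fun x y b => by
      simp [i₁, i₂, ← map_mul]
    rw [h2] at h1
    simp only [h3, map_sum, PosFun.sliceLeft_tmul] at h1
    rw [Matrix.map_apply, average_apply, Matrix.map_apply, ← ha, Algebra.algebraMap_eq_smul_one]
    refine Eq.trans ?_ h1
    simp only [Matrix.mul_apply, Finset.sum_mul, Matrix.map_apply]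
    refine Finset.sum_congr rfl fun s _ => Finset.sum_congr rfl fun r _ => ?_
    rw [← Algebra.commutes, mul_assoc, ← Algebra.smul_def]
    rfl
  unfold Intertwines
  have := congrArg (u.mat * ·) hE
  simp only [← Matrix.mul_assoc, (Unitary.mem_iff.1 u.mem_unitary).2, Matrix.one_mul] at this
  exact this

/-- Orthogonality of characters. -/
theorem homDim_eq_haar {h : PosFun Q} (h1 : h 1 = 1)
    (hh : ∀ a, h.sliceLeft (G.Δ a) = h a • (1 : Q)) (z u : FinRep G) :
    (homDim z u : ℂ) = h (star u.character * z.character) := by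
  -- Intertwiners are fixed because u*u = 1 and h(1) = 1; the dimension of the range is then the
  -- trace of the projection.
  have hproj : LinearMap.IsProj (homSpace z.mat u.mat) (average (h.toCLM : Q →ₗ[ℂ] ℂ) z u) := by
    refine ⟨fun B => average_mem hh z u B, fun B hB => ?_⟩
    have hB : B.map (algebraMap ℂ Q) * z.mat = u.mat * B.map (algebraMap ℂ Q) := hB
    rw [average_apply, Matrix.mul_assoc, hB, ← Matrix.mul_assoc,
      (Unitary.mem_iff.1 u.mem_unitary).1, Matrix.one_mul]
    ext i j
    simp [Algebra.algebraMap_eq_smul_one, h1]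
  rw [homDim, ← hproj.trace, LinearMap.trace_eq_matrix_trace ℂ (Matrix.stdBasis ℂ u.ι z.ι)]
  simp only [Matrix.trace, Matrix.diag_apply, LinearMap.toMatrix_apply, Fintype.sum_prod_type,
    Matrix.stdBasis_eq_single, character, star_sum, Finset.sum_mul_sum, map_sum]
  refine Finset.sum_congr rfl fun i _ => Finset.sum_congr rfl fun j _ => ?_
  have e : ∀ M : Matrix u.ι z.ι ℂ, (Matrix.stdBasis ℂ u.ι z.ι).repr M (i, j) = M i j := fun M => by
    rfl
  rw [e, average_apply, Matrix.map_apply]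
  -- The diagonal entry of averaging at a matrix unit; summed over i and j these give χ_u* χ_z under
  -- h.
  have e' : (star u.mat * (Matrix.single i j 1).map (algebraMap ℂ Q) * z.mat) i j =
      star (u.mat i i) * z.mat j j := by
    simp [Matrix.mul_apply, Matrix.single_apply, Matrix.star_apply, ite_and]
  rw [e']
  rfl

end FinRep

namespace CompactQuantumGroup

theorem IsIrreducible.isWeaklyIrreducible (hG : G.IsIrreducible) : G.IsWeaklyIrreducible := by
  have : IsDomain G.coefAlgebra := hG
  -- A domain is nontrivial, which excludes Q = 0, where no state exists.
  have : Nontrivial Q := (Subtype.val_injective (p := (· ∈ G.coefAlgebra))).nontrivial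
  obtain ⟨h, h1, hh⟩ := G.exists_haar
  let χ : FusionRing G →+* G.coefAlgebra :=
    FusionRing.lift (RepClass.character.codRestrict G.coefAlgebra RepClass.character_mem)
  refine Function.Injective.isDomain χ ((injective_iff_map_eq_zero χ).2 fun x hx => ?_)
  obtain ⟨a, b, rfl⟩ := x.exists_eq_sub
  rw [map_sub, sub_eq_zero, FusionRing.lift_of, FusionRing.lift_of] at hx
  have hab : RepClass.character a = RepClass.character b := congrArg Subtype.val hx
  rw [sub_eq_zero]
  congr 1
  -- Multiplicities are values of `h` on expressions in the character alone, so equal characters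
  -- give equal classes.
  refine RepClass.ext_homDim fun z _ => ?_
  induction a using RepClass.ind with | h u =>
  induction b using RepClass.ind with | h v =>
  rw [RepClass.character_mk, RepClass.character_mk] at hab
  rw [RepClass.homDim_mk, RepClass.homDim_mk, ← Nat.cast_inj (R := ℂ),
    FinRep.homDim_eq_haar h1 hh, FinRep.homDim_eq_haar h1 hh, hab]

end CompactQuantumGroup

end

end CQG

theorem mainTheorem1 {Q : Type*} [CStarAlgebra Q] (G : CQG.CompactQuantumGroup Q) :
    (G.IsIrreducible → G.IsWeaklyIrreducible) ∧ (G.IsWeaklyIrreducible → G.IsConnected) :=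
  ⟨fun h => h.isWeaklyIrreducible, fun h => h.isConnected⟩
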